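/- Let $\beta\in\{1,2,4\}$, let $\mathbb F=\mathbb R,\mathbb C,\mathbb H$ respectively, and let $0\le m<n$ be integers. Put $\gamma=1$ for $\beta=1,2$ and $\gamma=2$ for $\beta=4$. Let $\mathrm{Gl}=\mathrm{Gl}^{(\beta)}(n,m)=\mathbb F^{n\times(n-m)}\cong\mathbb R^{\beta n(n-m)}$, regarded as a real vector space with the real components of the matrix entries as coordinates. For $\beta=4$ the quaternion $(a,b,c,d)$ is represented by $\begin{pmatrix}a+b\imath&c+d\imath\\-c+d\imath&a-b\imath\end{pmatrix}$, so that all matrices are complex $\gamma n\times\gamma(n-m)$ matrices. Let $$\mathrm{St}=\mathrm{St}^{(\beta)}(n,m)=\{A\in\mathrm{Gl}: A^\dagger A=\mathbf 1\},$$ with the probability measure that is invariant under left multiplication by $\mathrm O(n)$ ($\beta=1$), $\mathrm U(n)$ ($\beta=2$), $\mathrm{USp}(2n)$ ($\beta=4$), that is, the image of normalized Haar measure under the map sending a group element to its first $n-m$ columns (over $\mathbb F$). (For $\beta=1$, $m=0$ this is $\mathrm O(n)$, not $\mathrm{SO}(n)$.) Define real polynomials $I_1,\dots,I_{n-m}$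 on $\mathrm{Gl}$ by $$\det(\mathbf 1+\mu B^\dagger B)=1+\sum_{j=1}^{n-m}\mu^jI_j(B)\quad(\beta=1,2),\qquad \mathrm{Pf}(J+\mu JB^\dagger B)=1+\sum_{j=1}^{n-m}\mu^jI_j(B)\quad(\beta=4),$$ where $J$ is block diagonal with $n-m$ blocks $\begin{pmatrix}0&1\\-1&0\end{pmatrix}$. The polynomial $I_j$ has degree $2j$ in the real coordinates. Also denote by $I_j=I_j(\imath\nabla)$ the differential operator with constant coefficients obtained by substituting $\imath$ times the partial derivatives for the real coordinates. For $B\in\mathrm{Gl}$ set $$\widehat\Psi(B)=\int_{\mathrm{St}}\exp\Big[\tfrac{\imath}{2\gamma}\big(\mathrm{tr}\,B^\dagger A+\mathrm{tr}\,A^\dagger B\big)\Big]\,dA .$$ For a formal power series $\Phi\in\mathbb R[[x_1,\dots,x_{n-m}]]$ and $N\in\mathbb N$ let $\Phi^{(N)}$ be the polynomial consisting of all terms of $\Phi$ of degree at most $N$, where $x_j$ is given degree $2j$. Let $\mathcal A^{(\beta)}(n,m)$ be the space of complex-valued functions $f$ that are smooth on some open set $\Omega\subset\mathrm{Gl}$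 with $\{\lambda A: A\in\mathrm{St},\ \lambda\in[0,1]\}\subset\Omega$ and whose Taylor series at the origin (summed by degree) converges to $f$ uniformly on $\Omega$. **Theorem.** For all such $\beta,n,m$ there is exactly one formal power series $\Psi=\Psi^{(\beta)}_{n,m}\in\mathbb R[[x_1,\dots,x_{n-m}]]$ with $$\Psi(I_1(B),\dots,I_{n-m}(B)):=\lim_{N\to\infty}\Psi^{(N)}(I_1(B),\dots,I_{n-m}(B))=\widehat\Psi(B)\qquad\text{for all }B\in\mathrm{Gl}.$$ Moreover every $f\in\mathcal A^{(\beta)}(n,m)$ is integrable over $\mathrm{St}$, and $$\int_{\mathrm{St}}f=\big(\Psi(I_1,\dots,I_{n-m})f\big)(0):=\lim_{N\to\infty}\big(\Psi^{(N)}(I_1,\dots,I_{n-m})f\big)(0),$$ where the limit on the right-hand side exists. -/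

import Mathlib

open MeasureTheory Filter Topology
open scoped ContDiff

noncomputable section

namespace Pizzetti

/-- The three classes: real (`β = 1`), complex (`β = 2`) and quaternion (`β = 4`). -/
inductive Dyson
  | real
  | complex
  | quaternion

/-- The Dyson index `β`, the real dimension of the underlying number field. -/
@[reducible] def Dyson.beta : Dyson → ℕ
  | .real => 1
  | .complex => 2
  | .quaternion => 4

/-- The size `γ` of the complex matrices that represent the numbers of the field. -/
@[reducible] def Dyson.gamma : Dyson → ℕ
  | .real => 1
  | .complex => 1
  | .quaternion => 2

/-- The real basis of the number field as complex `γ × γ` matrices: `1`; `1, i`;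
and `1, iτ₃, iτ₂, iτ₁` with the Pauli matrices `τ₁, τ₂, τ₃`. -/
def basisMat : (b : Dyson) → Fin b.beta → Matrix (Fin b.gamma) (Fin b.gamma) ℂ
  | .real => ![1]
  | .complex => ![1, !![Complex.I]]
  | .quaternion => ![1, !![Complex.I, 0; 0, -Complex.I], !![0, 1; -1, 0],
      !![0, Complex.I; Complex.I, 0]]

/-- The real coordinates of a number with respect to `basisMat`. -/
def coords : (b : Dyson) → Matrix (Fin b.gamma) (Fin b.gamma) ℂ → Fin b.beta → ℝ
  | .real => fun M => ![(M 0 0).re]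
  | .complex => fun M => ![(M 0 0).re, (M 0 0).im]
  | .quaternion => fun M => ![(M 0 0).re, (M 0 0).im, (M 0 1).re, (M 0 1).im]

/-- Indices of the real coordinates of an `n × (n - m)` matrix over the number field. -/
abbrev Idx (b : Dyson) (n m : ℕ) : Type := Fin n × Fin (n - m) × Fin b.beta

/-- The real vector space `Gl^(β)(n,m)` of `n × (n - m)` matrices over the number field, in its
real coordinates. -/
abbrev Gl (b : Dyson) (n m : ℕ) : Type := Idx b n m → ℝ

/-- The complex `γ n × γ (n - m)` matrix `B` with real coordinates `x`. The coordinates may lie in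
any commutative `ℂ`-algebra: complex numbers give values, indeterminates give polynomials. -/
def mat (b : Dyson) (n m : ℕ) {R : Type*} [CommRing R] [Algebra ℂ R] (x : Idx b n m → R) :
    Matrix (Fin n × Fin b.gamma) (Fin (n - m) × Fin b.gamma) R :=
  Matrix.of fun p q => ∑ c, algebraMap ℂ R (basisMat b c p.2 q.2) * x (p.1, q.1, c)

/-- The adjoint `B†` of the matrix `B` with the real coordinates `x`; the coordinates are
not conjugated. -/
def matAdj (b : Dyson) (n m : ℕ) {R : Type*} [CommRing R] [Algebra ℂ R] (x : Idx b n m → R) :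
    Matrix (Fin (n - m) × Fin b.gamma) (Fin n × Fin b.gamma) R :=
  Matrix.of fun q p => ∑ c, algebraMap ℂ R (star (basisMat b c p.2 q.2)) * x (p.1, q.1, c)

/-- The complex matrix of a point of `Gl^(β)(n,m)`. -/
def toMat {b : Dyson} {n m : ℕ} (A : Gl b n m) :
    Matrix (Fin n × Fin b.gamma) (Fin (n - m) × Fin b.gamma) ℂ :=
  mat b n m fun a => (A a : ℂ)

/-- The Stiefel manifold: all `A` with `A† A = 1`. -/
def stiefel (b : Dyson) (n m : ℕ) : Set (Gl b n m) :=
  {A | (toMat A).conjTranspose * toMat A = 1}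

/-! ### The invariants -/

/-- The Pfaffian of a matrix of even size `2k`, whose rows are ordered as
`(0,0), (0,1), (1,0), (1,1), …`. -/
def pfaffian {R : Type*} [CommRing R] [Algebra ℂ R] (k : ℕ)
    (C : Matrix (Fin k × Fin 2) (Fin k × Fin 2) R) : R :=
  algebraMap ℂ R (1 / ((k.factorial : ℂ) * 2 ^ k)) *
    ∑ s : Equiv.Perm (Fin k × Fin 2),
      ((Equiv.Perm.sign s : ℤ) : R) * ∏ j : Fin k, C (s (j, 0)) (s (j, 1))

/-- The block diagonal matrix with `k` blocks `iτ₂`. -/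
def symp (R : Type*) [CommRing R] (k : ℕ) : Matrix (Fin k × Fin 2) (Fin k × Fin 2) R :=
  Matrix.of fun p q => if p.1 = q.1 then (!![0, 1; -1, 0] : Matrix (Fin 2) (Fin 2) R) p.2 q.2 else 0

/-- The generating polynomial of the invariants in the variable `μ`: `det (1 + μ G)` for `β = 1, 2`
and `Pf (J + μ J G)` for `β = 4`, where `J` is block diagonal with blocks `iτ₂`. -/
def genPoly (b : Dyson) (k : ℕ) {R : Type*} [CommRing R] [Algebra ℂ R]
    (G : Matrix (Fin k × Fin b.gamma) (Fin k × Fin b.gamma) R) : Polynomial R :=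
  match b, G with
  | .real, G => (1 + (Polynomial.X : Polynomial R) • G.map Polynomial.C).det
  | .complex, G => (1 + (Polynomial.X : Polynomial R) • G.map Polynomial.C).det
  | .quaternion, G => pfaffian k
      (symp (Polynomial R) k + (Polynomial.X : Polynomial R) •
        (symp (Polynomial R) k * G.map Polynomial.C))

/-- The invariant `I_{j+1}(B)`, the coefficient of `μ^(j+1)` in the generating polynomial of
`B† B`, where `B` has the real coordinates `x`. -/
def invariant (b : Dyson) (n m : ℕ) {R : Type*} [CommRing R] [Algebra ℂ R] (x : Idx b n m → R)
    (j : Fin (n - m)) : R :=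
  (genPoly b (n - m) (matAdj b n m x * mat b n m x)).coeff (j + 1)

/-! ### Differential operators with constant coefficients -/

/-- The iterated partial derivative `∂^α f` at `x`. -/
def partialDeriv {ι : Type*} [Fintype ι] (α : ι →₀ ℕ) (f : (ι → ℝ) → ℂ) (x : ι → ℝ) : ℂ :=
  haveI := Classical.decEq ι
  iteratedFDeriv ℝ (Finsupp.toMultiset α).toList.length f x
    fun i => Pi.single ((Finsupp.toMultiset α).toList.get i) (1 : ℝ)

/-- The operator `P(∇)` obtained from the polynomial `P` by replacing the variables by the partial
derivatives. -/
def diffOp {ι : Type*} [Fintype ι] (P : MvPolynomial ι ℂ) (f : (ι → ℝ) → ℂ) (x : ι → ℝ) : ℂ :=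
  ∑ α ∈ P.support, P.coeff α * partialDeriv α f x

/-- The polynomial `P` with `P(∇) = I_{j+1}(i∇)`. -/
def invariantSymbol (b : Dyson) (n m : ℕ) (j : Fin (n - m)) : MvPolynomial (Idx b n m) ℂ :=
  invariant b n m (fun a => MvPolynomial.C Complex.I * MvPolynomial.X a) j

/-! ### The invariant measure -/

/-- The structure matrix of the antiunitary symmetry: `1` for `β = 1`, and block diagonal with
blocks `iτ₂` for `β = 4`. It plays no role for `β = 2`. -/
def structMat : (b : Dyson) → (n : ℕ) → Matrix (Fin n × Fin b.gamma) (Fin n × Fin b.gamma) ℂ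
  | .real, _ => 1
  | .complex, _ => 1
  | .quaternion, n => symp ℂ n

/-- The compact groups `O(n)`, `U(n)` and `USp(2n)`: unitary matrices `U` that are arbitrary for
`β = 2`, satisfy `U* = U` for `β = 1`, and `U* J = J U` (that is, are matrices of quaternions) for
`β = 4`. -/
def unitaryGrp (b : Dyson) (n : ℕ) : Subgroup (Matrix.unitaryGroup (Fin n × Fin b.gamma) ℂ) where
  carrier := {U | b ≠ .complex →
    U.1.map star * structMat b n = structMat b n * U.1}
  one_mem' := by
    intro _
    simp [Matrix.map_one]
  mul_mem' := by
    intro U V hU hV hb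
    have hmap : (U * V).1.map star
        = U.1.map star * V.1.map star := by
      rw [Matrix.UnitaryGroup.mul_val]
      exact Matrix.map_mul (f := starRingEnd ℂ)
    rw [hmap, Matrix.mul_assoc, hV hb, ← Matrix.mul_assoc, hU hb, Matrix.mul_assoc,
      Matrix.UnitaryGroup.mul_val]
  inv_mem' := by
    intro U hU hb
    have hmap : ∀ A B : Matrix (Fin n × Fin b.gamma) (Fin n × Fin b.gamma) ℂ,
        (A * B).map star = A.map star * B.map star := fun A B =>
      Matrix.map_mul (f := starRingEnd ℂ)
    have h1 : (U⁻¹).1 * U.1 = 1 := by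
      rw [← Matrix.UnitaryGroup.mul_val, inv_mul_cancel, Matrix.UnitaryGroup.one_val]
    have h2 : U.1 * (U⁻¹).1 = 1 := by
      rw [← Matrix.UnitaryGroup.mul_val, mul_inv_cancel, Matrix.UnitaryGroup.one_val]
    have h3 : (U⁻¹).1.map star *
        U.1.map star = 1 := by
      rw [← hmap, h1]
      simp [Matrix.map_one]
    calc (U⁻¹).1.map star * structMat b n
        = (U⁻¹).1.map star *
            (structMat b n * U.1) *
              (U⁻¹).1 := by
          rw [Matrix.mul_assoc, Matrix.mul_assoc, h2, Matrix.mul_one]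
      _ = _ := by
          rw [← hU hb, ← Matrix.mul_assoc, h3, Matrix.one_mul]

instance (b : Dyson) (n : ℕ) : MeasurableSpace (unitaryGrp b n) := borel _

instance (b : Dyson) (n : ℕ) : BorelSpace (unitaryGrp b n) := ⟨rfl⟩

instance (b : Dyson) (n : ℕ) : CompactSpace (unitaryGrp b n) := by
  have hK : IsCompact {M : Matrix (Fin n × Fin b.gamma) (Fin n × Fin b.gamma) ℂ |
      M ∈ Matrix.unitaryGroup (Fin n × Fin b.gamma) ℂ ∧
        (b ≠ .complex → M.map star * structMat b n = structMat b n * M)} := by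
    have hbox : IsCompact (Set.univ.pi fun _ : Fin n × Fin b.gamma =>
        Set.univ.pi fun _ : Fin n × Fin b.gamma => Metric.closedBall (0 : ℂ) 1) :=
      isCompact_univ_pi fun _ => isCompact_univ_pi fun _ => isCompact_closedBall _ _
    refine IsCompact.of_isClosed_subset hbox ?_ ?_
    · refine IsClosed.inter (isClosed_unitary (R := Matrix _ _ ℂ)) ?_
      by_cases hb : b = .complex
      · have huniv : {M : Matrix (Fin n × Fin b.gamma) (Fin n × Fin b.gamma) ℂ |
            b ≠ .complex → M.map star * structMat b n = structMat b n * M} = Set.univ :=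
          Set.eq_univ_of_forall fun M h => absurd hb h
        change IsClosed {M : Matrix (Fin n × Fin b.gamma) (Fin n × Fin b.gamma) ℂ |
          b ≠ .complex → M.map star * structMat b n = structMat b n * M}
        rw [huniv]
        exact isClosed_univ
      · have hiff : ∀ p : Prop, (b ≠ .complex → p) ↔ p := fun p => ⟨fun h => h hb, fun h _ => h⟩
        change IsClosed {M : Matrix (Fin n × Fin b.gamma) (Fin n × Fin b.gamma) ℂ |
          b ≠ .complex → M.map star * structMat b n = structMat b n * M}
        simp only [hiff]
        refine isClosed_eq ?_ ?_
        · exact (continuous_id.matrix_map continuous_star).matrix_mul continuous_const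
        · exact continuous_const.matrix_mul continuous_id
    · intro M hM i _ j _
      exact mem_closedBall_zero_iff.2 (entry_norm_bound_of_unitary hM.1 i j)
  have hrange : IsCompact (Set.range fun U : unitaryGrp b n =>
      U.1.1) := by
    convert hK using 1
    ext M
    constructor
    · rintro ⟨U, rfl⟩
      exact ⟨U.1.2, U.2⟩
    · rintro ⟨h1, h2⟩
      exact ⟨⟨⟨M, h1⟩, h2⟩, rfl⟩
  have hind : IsInducing fun U : unitaryGrp b n =>
      U.1.1 :=
    IsInducing.subtypeVal.comp IsInducing.subtypeVal
  exact isCompact_univ_iff.1 (hind.isCompact_iff.2 (by rwa [Set.image_univ]))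

/-- The first `n - m` columns of a group element, as a point of `Gl^(β)(n,m)`. -/
def frame (b : Dyson) (n m : ℕ) (U : unitaryGrp b n) : Gl b n m := fun a =>
  coords b (Matrix.of fun s t =>
    U.1.1
      (a.1, s) (Fin.castLE (Nat.sub_le n m) a.2.1, t)) a.2.2

/-- The left-invariant probability measure on the Stiefel manifold, as a measure on `Gl^(β)(n,m)`:
the image of the normalized Haar measure of the group. -/
def stiefelMeasure (b : Dyson) (n m : ℕ) : Measure (Gl b n m) :=
  (Measure.haarMeasure (⊤ : TopologicalSpace.PositiveCompacts (unitaryGrp b n))).map (frame b n m)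

/-! ### The power series and the space of functions -/

/-- The Leutwyler–Smilga integral: the integral over the Stiefel manifold of the Fourier kernel
`exp (i (tr B† A + tr A† B) / (2γ))`. -/
def psiHat (b : Dyson) (n m : ℕ) (B : Gl b n m) : ℂ :=
  ∫ A, Complex.exp (Complex.I *
    (((toMat B).conjTranspose * toMat A).trace + ((toMat A).conjTranspose * toMat B).trace) /
      (2 * (b.gamma : ℂ))) ∂(stiefelMeasure b n m)

/-- The multi-indices `α` with `∑ 2 (j + 1) α_j ≤ N`. -/
def lowWeight (k N : ℕ) : Finset (Fin k →₀ ℕ) :=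
  (Finset.Iic (Finsupp.equivFunOnFinite.symm fun _ => N)).filter
    fun α => ∑ j : Fin k, 2 * ((j : ℕ) + 1) * α j ≤ N

/-- The truncation of a formal power series in `x_1, …, x_k` to all terms of degree at most `N`,
where `x_j` has degree `2j` (the degree of the invariant `I_j`). -/
def truncate {k : ℕ} (Φ : MvPowerSeries (Fin k) ℝ) (N : ℕ) : MvPolynomial (Fin k) ℝ :=
  MvPowerSeries.truncFinset ℝ (lowWeight k N) Φ

/-- The power series `Φ` satisfies `Φ(I_1(B), …, I_{n-m}(B)) = Ψ̂(B)` for all `B`. -/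
def RepresentsPsiHat (b : Dyson) (n m : ℕ) (Φ : MvPowerSeries (Fin (n - m)) ℝ) : Prop :=
  ∀ B : Gl b n m,
    Tendsto (fun N => MvPolynomial.aeval (invariant b n m fun a => (B a : ℂ)) (truncate Φ N))
      atTop (𝓝 (psiHat b n m B))

/-- The space `𝒜^(β)(n,m)`: functions that are smooth on an open set which contains all `λ A` with
`A` in the Stiefel manifold and `0 ≤ λ ≤ 1`, and on which the Taylor series at the origin
converges uniformly to the function. -/
def analyticSpace (b : Dyson) (n m : ℕ) : Set (Gl b n m → ℂ) :=
  {f | ∃ Ω : Set (Gl b n m), IsOpen Ω ∧ ContDiffOn ℝ ∞ f Ω ∧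
    (∀ A ∈ stiefel b n m, ∀ t ∈ Set.Icc (0 : ℝ) 1, t • A ∈ Ω) ∧
    TendstoUniformlyOn
      (fun N x => ∑ d ∈ Finset.range N,
        ((d.factorial : ℂ))⁻¹ * iteratedFDeriv ℝ d f 0 fun _ => x) f atTop Ω}

end Pizzetti

end

/-! The exponent of the kernel is `i` times the Euclidean product `B ⬝ᵥ A` of the real coordinates.
Hence Ψ̂(B) = Σ_e (-1)^e/(2e)! · M_{2e}(B) with the moments M_d(B) = ∫ (B·A)^d dA; the odd moments
vanish because -1 lies in the group (`tendsto_psiHat`).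

Each M_{2e} is a homogeneous polynomial invariant under B ↦ UBV. By the singular value decomposition
over the field (`exists_act_eq_diagGl`) it is determined by its values on rectangular diagonal
matrices. There, invariance under permutations and sign changes makes it an even symmetric
polynomial in the singular values y_i, that is, a polynomial in the elementary symmetric polynomials
of the y_i². These are the values of the I_j, so M_{2e} is a polynomial in the I_j on all of Gl
(`exists_momentInvariant`), and these polynomials assemble to Ψ.

For uniqueness, replacing B by √s·B multiplies the terms of weight e by s^e. A power series in s
that converges to 0 for all s ≥ 0 is zero, so Ψ̂ prescribes each weighted homogeneous part
(`representsPsiHat_iff`). On diagonal matrices the I_j are algebraically independent, so the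
coefficients are determined (`homPart_ext`).

The integral formula is the same identity read between polynomials, with i∇ in place of B. The sign
i^{2e} cancels (-1)^e, so the part of degree 2e of Ψ(I(i∇)) is 1/(2e)! ∫ (A·∇)^{2e} dA
(`aeval_invariantSymbol_homPart`). Applied to f at 0, it is the integral of the Taylor term of
degree 2e, and uniform convergence of the Taylor series allows termwise integration. -/

noncomputable section

namespace Pizzetti

/-! ### Iterated directional derivatives -/

section Calculus

variable {E F : Type*} [NormedAddCommGroup E] [NormedSpace ℝ E] [NormedAddCommGroup F]
  [NormedSpace ℝ F]

/-- The iterated directional derivative along the vectors of a list. -/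
def dirDeriv (f : E → F) : List E → E → F
  | [] => f
  | v :: l => fun x => fderiv ℝ (dirDeriv f l) x v

theorem contDiffOn_dirDeriv {f : E → F} {s : Set E} (hs : IsOpen s) (hf : ContDiffOn ℝ ∞ f s)
    (l : List E) : ContDiffOn ℝ ∞ (dirDeriv f l) s := by
  induction l with
  | nil => exact hf
  | cons v l ih =>
    exact (ih.fderiv_of_isOpen hs (m := ∞) (by simp)).clm_apply contDiffOn_const

/-- Needed because `partialDeriv` differentiates in the arbitrary order chosen by `Multiset.toList`.
Adjacent swaps generate all permutations, and for a swap the claim is the symmetry of the second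
derivative. -/
theorem dirDeriv_perm {f : E → F} {s : Set E} (hs : IsOpen s) (hf : ContDiffOn ℝ ∞ f s)
    {l l' : List E} (h : l.Perm l') : ∀ x ∈ s, dirDeriv f l x = dirDeriv f l' x := by
  induction h with
  | nil => intro x _; rfl
  | cons v _ ih =>
    intro x hx
    have he : dirDeriv f _ =ᶠ[𝓝 x] dirDeriv f _ := Filter.eventuallyEq_of_mem (hs.mem_nhds hx) ih
    simp only [dirDeriv]
    rw [he.fderiv_eq]
  | trans _ _ ih₁ ih₂ => intro x hx; rw [ih₁ x hx, ih₂ x hx]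
  | swap v w l =>
    intro x hx
    have hc : ContDiffAt ℝ ∞ (dirDeriv f l) x := (contDiffOn_dirDeriv hs hf l).contDiffAt (hs.mem_nhds hx)
    have hd : DifferentiableAt ℝ (fderiv ℝ (dirDeriv f l)) x :=
      (hc.fderiv_right (m := 1) (WithTop.coe_le_coe.2 le_top)).differentiableAt (by simp)
    have hsymm : IsSymmSndFDerivAt ℝ (dirDeriv f l) x :=
      hc.isSymmSndFDerivAt (by
        rw [minSmoothness_of_isRCLikeNormedField]
        exact WithTop.coe_le_coe.2 le_top)
    simp only [dirDeriv]
    rw [fderiv_clm_apply hd (differentiableAt_const _), fderiv_clm_apply hd (differentiableAt_const _)]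
    simpa using hsymm.eq w v

theorem iteratedFDeriv_eq_dirDeriv {f : E → F} {s : Set E} (hs : IsOpen s)
    (hf : ContDiffOn ℝ ∞ f s) (n : ℕ) : ∀ (v : Fin n → E), ∀ x ∈ s,
      iteratedFDeriv ℝ n f x v = dirDeriv f (List.ofFn v) x := by
  induction n with
  | zero => intro v x _; simp [dirDeriv]
  | succ n ih =>
    intro v x hx
    have hc : ContDiffAt ℝ ∞ f x := hf.contDiffAt (hs.mem_nhds hx)
    have hd : DifferentiableAt ℝ (iteratedFDeriv ℝ n f) x :=
      (hc.iteratedFDeriv_right (m := 1) (i := n) (by exact_mod_cast le_top)).differentiableAt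
        (by simp)
    rw [hd.iteratedFDeriv_succ_apply_left', List.ofFn_succ]
    simp only [dirDeriv]
    have he : (fun y => iteratedFDeriv ℝ n f y (Fin.tail v)) =ᶠ[𝓝 x]
        dirDeriv f (List.ofFn fun i : Fin n => v i.succ) :=
      Filter.eventuallyEq_of_mem (hs.mem_nhds hx) fun y hy => ih _ y hy
    rw [he.fderiv_eq]

end Calculus

/-! ### Constant-coefficient operators -/

section DiffOp

variable {ι : Type*} [Fintype ι] (f : (ι → ℝ) → ℂ) (x : ι → ℝ)

theorem diffOp_eq_sum (P : MvPolynomial ι ℂ) {S : Finset (ι →₀ ℕ)} (hS : P.support ⊆ S) :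
    diffOp P f x = ∑ α ∈ S, P.coeff α * partialDeriv α f x := by
  refine Finset.sum_subset hS fun α _ hα => ?_
  rw [MvPolynomial.notMem_support_iff.1 hα, zero_mul]

/-- `diffOp` as a linear map in the symbol. -/
def diffOpLin : MvPolynomial ι ℂ →ₗ[ℂ] ℂ where
  toFun P := diffOp P f x
  map_add' P Q := by
    classical
    rw [diffOp_eq_sum f x (P + Q) MvPolynomial.support_add,
      diffOp_eq_sum f x P Finset.subset_union_left,
      diffOp_eq_sum f x Q Finset.subset_union_right, ← Finset.sum_add_distrib]
    exact Finset.sum_congr rfl fun α _ => by rw [MvPolynomial.coeff_add, add_mul]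
  map_smul' c P := by
    rw [diffOp_eq_sum f x (c • P) MvPolynomial.support_smul, diffOp, RingHom.id_apply,
      smul_eq_mul, Finset.mul_sum]
    exact Finset.sum_congr rfl fun α _ => by rw [MvPolynomial.coeff_smul, smul_eq_mul, mul_assoc]

theorem diffOpLin_monomial (α : ι →₀ ℕ) (c : ℂ) :
    diffOpLin f x (MvPolynomial.monomial α c) = c * partialDeriv α f x := by
  classical
  change diffOp _ f x = _
  rw [diffOp_eq_sum f x _ MvPolynomial.support_monomial_subset, Finset.sum_singleton,
    MvPolynomial.coeff_monomial, if_pos rfl]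

/-- Monomials appear here as products over index sequences `g`, the form in which both (B·A)^d and
D^d f(A,…,A) expand. -/
theorem diffOpLin_prod_X [DecidableEq ι] {f : (ι → ℝ) → ℂ} {s : Set (ι → ℝ)} (hs : IsOpen s)
    (hf : ContDiffOn ℝ ∞ f s) {x : ι → ℝ} (hx : x ∈ s) {d : ℕ} (g : Fin d → ι) :
    diffOpLin f x (∏ i, MvPolynomial.X (g i)) =
      iteratedFDeriv ℝ d f x fun i => Pi.single (g i) (1 : ℝ) := by
  have hprod : (∏ i, MvPolynomial.X (g i) : MvPolynomial ι ℂ) =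
      MvPolynomial.monomial (∑ i, Finsupp.single (g i) 1) 1 := by
    rw [MvPolynomial.monomial_sum_one]; rfl
  rw [hprod, diffOpLin_monomial, one_mul, partialDeriv, iteratedFDeriv_eq_dirDeriv hs hf _ _ _ hx,
    iteratedFDeriv_eq_dirDeriv hs hf _ _ _ hx]
  refine dirDeriv_perm hs hf ?_ x hx
  have hm : Finsupp.toMultiset (∑ i, Finsupp.single (g i) 1) = ((List.ofFn g : List ι) : Multiset ι) := by
    simp only [map_sum, Finsupp.toMultiset_single, one_smul]
    rw [← Fin.univ_val_map, Finset.sum, ← Multiset.sum_map_singleton (Multiset.map g _),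
      Multiset.map_map]
    rfl
  have h1 : (Finsupp.toMultiset (∑ i, Finsupp.single (g i) 1)).toList.Perm (List.ofFn g) := by
    rw [← Multiset.coe_eq_coe, Multiset.coe_toList, hm]
  have h2 := h1.map (fun a => (Pi.single a (1 : ℝ) : ι → ℝ))
  rw [List.map_ofFn] at h2
  refine List.Perm.trans (List.Perm.of_eq ?_) h2
  conv_rhs => rw [← List.ofFn_get (Finsupp.toMultiset (∑ i, Finsupp.single (g i) 1)).toList]
  rw [List.map_ofFn]
  congr 1
  funext i
  simp only [Function.comp]
  -- `partialDeriv` uses the classical `DecidableEq` instance, the statement an arbitrary one.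
  congr!

end DiffOp

/-! ### Vanishing of power series -/

/-- Convergence at s = 1 bounds the coefficients by some C, so absolute convergence need not be
assumed. If all c_i with i < e vanish, the tail after c_e is at most 2C·s^(e+1) for s ≤ 1/2, whence
‖c_e‖ ≤ 2C·s, and s tends to 0. -/
theorem eq_zero_of_tendsto_partial_sums {c : ℕ → ℂ}
    (h : ∀ s : ℝ, 0 ≤ s → Tendsto (fun N => ∑ e ∈ Finset.range N, (s : ℂ) ^ e * c e) atTop (𝓝 0)) :
    ∀ e, c e = 0 := by
  have h0 : Tendsto c atTop (𝓝 0) := by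
    have h1 := h 1 zero_le_one
    have h2 := ((tendsto_add_atTop_iff_nat 1).2 h1).sub h1
    simpa [Finset.sum_range_succ] using h2
  obtain ⟨C, hC⟩ : ∃ C, ∀ e, ‖c e‖ ≤ C := by
    obtain ⟨C, hC⟩ := (Metric.isBounded_range_of_tendsto c h0).exists_norm_le
    exact ⟨C, fun e => hC _ ⟨e, rfl⟩⟩
  have hC0 : 0 ≤ C := (norm_nonneg _).trans (hC 0)
  intro e
  induction e using Nat.strong_induction_on with
  | _ e ih =>
    have key : ∀ s : ℝ, 0 < s → s ≤ 1 / 2 → ‖c e‖ ≤ s * (2 * C) := by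
      intro s hs hs2
      have hsum : ∀ N, ‖∑ i ∈ Finset.range (e + 1 + N), (s : ℂ) ^ i * c i - (s : ℂ) ^ e * c e‖ ≤
          s ^ (e + 1) * (2 * C) := by
        intro N
        rw [Finset.sum_range_add, Finset.sum_range_succ,
          Finset.sum_eq_zero (fun i hi => by rw [ih i (Finset.mem_range.1 hi), mul_zero]),
          zero_add, add_sub_cancel_left]
        calc ‖∑ i ∈ Finset.range N, (s : ℂ) ^ (e + 1 + i) * c (e + 1 + i)‖
            ≤ ∑ i ∈ Finset.range N, s ^ (e + 1) * C * (1 / 2) ^ i := by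
              refine norm_sum_le_of_le _ fun i _ => ?_
              rw [norm_mul, norm_pow, Complex.norm_real, Real.norm_of_nonneg hs.le, pow_add]
              have : s ^ i ≤ (1 / 2) ^ i := pow_le_pow_left₀ hs.le hs2 i
              calc s ^ (e + 1) * s ^ i * ‖c (e + 1 + i)‖ ≤ s ^ (e + 1) * (1 / 2) ^ i * C := by
                    gcongr; exact hC _
                _ = _ := by ring
          _ ≤ _ := by
              rw [← Finset.mul_sum]
              have := sum_geometric_two_le N
              have h3 : 0 ≤ s ^ (e + 1) * C := by positivity
              nlinarith
      have hlim := ((tendsto_add_atTop_iff_nat (e + 1)).2 (h s hs.le)).sub_const ((s : ℂ) ^ e * c e)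
      have := le_of_tendsto hlim.norm (Eventually.of_forall fun N => by
        rw [add_comm N]; exact hsum N)
      rw [zero_sub, norm_neg, norm_mul, norm_pow, Complex.norm_real, Real.norm_of_nonneg hs.le,
        pow_succ, mul_assoc] at this
      exact le_of_mul_le_mul_left this (by positivity)
    have hlim : Tendsto (fun s : ℝ => s * (2 * C)) (𝓝[>] 0) (𝓝 0) := by
      have : Tendsto (fun s : ℝ => s * (2 * C)) (𝓝 0) (𝓝 (0 * (2 * C))) :=
        (continuous_id.mul continuous_const).tendsto 0
      rw [zero_mul] at this
      exact this.mono_left nhdsWithin_le_nhds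
    have hle := ge_of_tendsto hlim (by
      filter_upwards [Ioc_mem_nhdsGT (show (0 : ℝ) < 1 / 2 by norm_num)] with s hs
      exact key s hs.1 hs.2)
    exact norm_le_zero_iff.1 hle

/-! ### Even symmetric polynomials -/

/-- Changing the sign of y_i multiplies the coefficient at β by (-1)^(β i), so only even exponents
survive and can be halved. -/
theorem exists_expand_two_of_even {σ : Type*} [Fintype σ] [DecidableEq σ] {P : MvPolynomial σ ℝ}
    (hP : ∀ i (y : σ → ℝ), MvPolynomial.eval (Function.update y i (-y i)) P = MvPolynomial.eval y P) :
    ∃ Q : MvPolynomial σ ℝ, MvPolynomial.expand 2 Q = P := by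
  have heven : ∀ α ∈ P.support, ∀ i, Even (α i) := by
    intro α hα i
    have hpoly : MvPolynomial.aeval (fun j => if j = i then -MvPolynomial.X j else
        (MvPolynomial.X j : MvPolynomial σ ℝ)) P = P := by
      refine MvPolynomial.funext fun y => ?_
      rw [← hP i y, MvPolynomial.aeval_def, MvPolynomial.eval₂_eq', map_sum, MvPolynomial.eval_eq']
      refine Finset.sum_congr rfl fun β _ => ?_
      simp only [map_mul, map_prod, map_pow, MvPolynomial.algebraMap_eq, MvPolynomial.eval_C]
      congr 1
      refine Finset.prod_congr rfl fun j _ => ?_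
      by_cases hj : j = i
      · subst hj; simp
      · simp [hj]
    have hcoeff : ∀ β : σ →₀ ℕ, MvPolynomial.aeval (fun j => if j = i then -MvPolynomial.X j else
        (MvPolynomial.X j : MvPolynomial σ ℝ)) (MvPolynomial.monomial β (P.coeff β)) =
        MvPolynomial.monomial β ((-1) ^ (β i) * P.coeff β) := by
      intro β
      rw [MvPolynomial.aeval_monomial, MvPolynomial.algebraMap_eq, Finsupp.prod_fintype _ _ (by simp)]
      have : ∀ j, (if j = i then -MvPolynomial.X j else (MvPolynomial.X j : MvPolynomial σ ℝ)) ^ β j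
          = (if j = i then (-1) ^ (β i) else 1) * MvPolynomial.X j ^ β j := by
        intro j
        by_cases hj : j = i
        · rw [if_pos hj, if_pos hj, neg_pow, hj]
        · simp [hj]
      simp only [this, Finset.prod_mul_distrib, Finset.prod_ite_eq', Finset.mem_univ, if_true]
      rw [MvPolynomial.monomial_eq (s := β), Finsupp.prod_fintype _ _ (by simp)]
      simp only [map_mul, map_pow, map_neg, map_one]
      ring
    have h2 : (MvPolynomial.coeff α P) = (-1) ^ (α i) * P.coeff α := by
      conv_lhs => rw [← hpoly, P.as_sum, map_sum, MvPolynomial.coeff_sum]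
      simp only [hcoeff, MvPolynomial.coeff_monomial]
      rw [Finset.sum_ite_eq' , if_pos hα]
    by_contra hodd
    rw [Nat.not_even_iff_odd] at hodd
    rw [hodd.neg_one_pow] at h2
    exact MvPolynomial.mem_support_iff.1 hα (by linarith)
  refine ⟨∑ α ∈ P.support, MvPolynomial.monomial (α.mapRange (· / 2) (by simp)) (P.coeff α), ?_⟩
  conv_rhs => rw [P.as_sum]
  rw [map_sum]
  refine Finset.sum_congr rfl fun α hα => ?_
  rw [MvPolynomial.expand_monomial]
  congr 2
  ext i
  simpa using Nat.mul_div_cancel' (heven α hα i).two_dvd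

/-- Halving the exponents keeps the symmetry; the fundamental theorem on symmetric polynomials then
applies. -/
theorem exists_aeval_esymm_sq {k : ℕ} {P : MvPolynomial (Fin k) ℝ}
    (heven : ∀ i (y : Fin k → ℝ),
      MvPolynomial.eval (Function.update y i (-y i)) P = MvPolynomial.eval y P)
    (hsymm : ∀ (σ : Equiv.Perm (Fin k)) (y : Fin k → ℝ),
      MvPolynomial.eval (y ∘ σ) P = MvPolynomial.eval y P) :
    ∃ r : MvPolynomial (Fin k) ℝ, ∀ y : Fin k → ℝ,
      MvPolynomial.aeval (fun i : Fin k => MvPolynomial.aeval (fun j => y j ^ 2)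
        (MvPolynomial.esymm (Fin k) ℝ (i + 1))) r = MvPolynomial.eval y P := by
  obtain ⟨Q, hQ⟩ := exists_expand_two_of_even heven
  have hQs : Q.IsSymmetric := by
    intro σ
    apply MvPolynomial.expand_injective (n := 2) (by norm_num)
    rw [← MvPolynomial.rename_expand, hQ]
    refine MvPolynomial.funext fun y => ?_
    rw [MvPolynomial.eval_rename, hsymm]
  obtain ⟨r, hr⟩ := MvPolynomial.esymmAlgHom_fin_surjective ℝ (le_refl k)
    ⟨Q, (MvPolynomial.mem_symmetricSubalgebra _).2 hQs⟩
  refine ⟨r, fun y => ?_⟩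
  have hr' : MvPolynomial.aeval (fun i : Fin k => MvPolynomial.esymm (Fin k) ℝ (i + 1)) r = Q := by
    rw [← MvPolynomial.esymmAlgHom_apply, hr]
  rw [← hQ, ← MvPolynomial.coe_aeval_eq_eval, RingHom.coe_coe, MvPolynomial.aeval_expand, ← hr',
    MvPolynomial.comp_aeval_apply]
  rfl

/-- The algebraic independence of the elementary symmetric polynomials, which substituting squares
does not destroy. -/
theorem eq_zero_of_aeval_esymm_sq {k : ℕ} {p : MvPolynomial (Fin k) ℝ}
    (h : ∀ y : Fin k → ℝ, MvPolynomial.aeval (fun i : Fin k => MvPolynomial.aeval (fun j => y j ^ 2)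
        (MvPolynomial.esymm (Fin k) ℝ (i + 1))) p = 0) : p = 0 := by
  apply (MvPolynomial.esymmAlgHom_fin_bijective ℝ k).1
  apply Subtype.ext
  rw [map_zero, MvPolynomial.esymmAlgHom_apply, ZeroMemClass.coe_zero]
  apply MvPolynomial.expand_injective (n := 2) (by norm_num)
  refine MvPolynomial.funext fun y => ?_
  rw [← MvPolynomial.coe_aeval_eq_eval, RingHom.coe_coe, MvPolynomial.aeval_expand,
    MvPolynomial.comp_aeval_apply, map_zero, map_zero]
  exact h y

/-! ### The Pfaffian -/

section Pfaffian

variable {R S : Type*} [CommRing R] [Algebra ℂ R] [CommRing S] [Algebra ℂ S]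

theorem pfaffian_map (φ : R →ₐ[ℂ] S) (k : ℕ) (C : Matrix (Fin k × Fin 2) (Fin k × Fin 2) R) :
    pfaffian k (C.map φ) = φ (pfaffian k C) := by
  simp [pfaffian, map_sum, map_prod]

/-- Multilinear expansion gives a sum over all maps f of ∏ C(f(j,0), f(j,1)) times the determinant
of the rows of V chosen by f. A map that is not injective repeats a row and contributes 0; a
permutation contributes its sign times det V. Antisymmetry of C plays no role, since the defining
sum runs over all permutations. -/
theorem pfaffian_transpose_mul_mul (k : ℕ) (V C : Matrix (Fin k × Fin 2) (Fin k × Fin 2) R) :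
    pfaffian k (V.transpose * C * V) = V.det * pfaffian k C := by
  have hentry : ∀ a b, (V.transpose * C * V) a b =
      ∑ pq : (Fin k × Fin 2) × (Fin k × Fin 2), V pq.1 a * C pq.1 pq.2 * V pq.2 b := by
    intro a b
    rw [Fintype.sum_prod_type_right, Matrix.mul_apply]
    simp only [Matrix.mul_apply, Matrix.transpose_apply, Finset.sum_mul]
  let e : (Fin k × Fin 2 → Fin k × Fin 2) ≃ (Fin k → (Fin k × Fin 2) × (Fin k × Fin 2)) :=
    (Equiv.curry _ _ _).trans ((Equiv.refl _).arrowCongr (finTwoArrowEquiv _))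
  have he : ∀ f j, e f j = (f (j, 0), f (j, 1)) := fun f j => rfl
  have hprod : ∀ s : Equiv.Perm (Fin k × Fin 2),
      ∏ j : Fin k, (V.transpose * C * V) (s (j, 0)) (s (j, 1)) =
        ∑ f : Fin k × Fin 2 → Fin k × Fin 2,
          (∏ j : Fin k, C (f (j, 0)) (f (j, 1))) * ∏ x, V (f x) (s x) := by
    intro s
    simp only [hentry]
    rw [Finset.prod_univ_sum, Fintype.piFinset_univ, ← e.sum_comp]
    refine Finset.sum_congr rfl fun f _ => ?_
    simp only [he, Fintype.prod_prod_type, Fin.prod_univ_two, ← Finset.prod_mul_distrib]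
    exact Finset.prod_congr rfl fun j _ => by ring
  have hdet : ∀ f : Fin k × Fin 2 → Fin k × Fin 2,
      ∑ s : Equiv.Perm (Fin k × Fin 2), ((Equiv.Perm.sign s : ℤ) : R) * ∏ x, V (f x) (s x) =
        (V.submatrix f id).det := by
    intro f
    rw [← Matrix.det_transpose, Matrix.det_apply']
    rfl
  rw [pfaffian, pfaffian, mul_left_comm]
  congr 1
  simp only [hprod, Finset.mul_sum]
  rw [Finset.sum_comm]
  symm
  refine Finset.sum_of_injOn (fun π : Equiv.Perm (Fin k × Fin 2) => (π : _ → _))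
    (fun _ _ _ _ h => DFunLike.coe_injective h) (fun _ _ => Finset.mem_coe.2 (Finset.mem_univ _))
    ?_ ?_
  · intro f _ hf
    have hni : ¬ Function.Injective f := fun hi =>
      hf ⟨Equiv.ofBijective f (Finite.injective_iff_bijective.1 hi), by simp, rfl⟩
    simp only [mul_left_comm _ (∏ j : Fin k, C (f (j, 0)) (f (j, 1))), ← Finset.mul_sum]
    rw [hdet]
    obtain ⟨i, j, hij, hne⟩ : ∃ i j, f i = f j ∧ i ≠ j := by
      unfold Function.Injective at hni
      push Not at hni
      exact hni
    rw [Matrix.det_zero_of_row_eq hne (by ext c; simp [hij]), mul_zero]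
  · intro π _
    simp only [mul_left_comm _ (∏ j : Fin k, C (π (j, 0)) (π (j, 1))), ← Finset.mul_sum]
    rw [hdet, Matrix.det_permute]
    ring

omit [Algebra ℂ R] in
theorem symp_mul_self (k : ℕ) : symp R k * symp R k = -1 := by
  ext ⟨i, s⟩ ⟨j, t⟩
  simp only [Matrix.mul_apply, symp, Matrix.of_apply, Fintype.sum_prod_type, ite_mul, zero_mul,
    mul_ite, mul_zero, Fin.sum_univ_two, Matrix.neg_apply, Matrix.one_apply, Prod.mk.injEq]
  by_cases h : i = j
  · subst h
    fin_cases s <;> fin_cases t <;> simp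
  · have h' : ∀ x, (x = j → ¬ i = x) := fun x hx hi => h (hi.trans hx)
    simp only [h, false_and, if_false, neg_zero]
    refine Finset.sum_eq_zero fun x _ => ?_
    by_cases hx : x = j
    · simp [h' x hx]
    · simp [hx]

omit [Algebra ℂ R] in
theorem symp_transpose (k : ℕ) : (symp R k).transpose = -symp R k := by
  ext ⟨i, s⟩ ⟨j, t⟩
  simp only [Matrix.transpose_apply, symp, Matrix.of_apply, Matrix.neg_apply]
  by_cases h : i = j
  · subst h
    fin_cases s <;> fin_cases t <;> simp
  · simp [h, Ne.symm h]

omit [Algebra ℂ R] [Algebra ℂ S] in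
theorem symp_map {F : Type*} [FunLike F R S] [RingHomClass F R S] (φ : F) (k : ℕ) : (symp R k).map φ = symp S k := by
  ext ⟨i, s⟩ ⟨j, t⟩
  simp only [symp, Matrix.of_apply, Matrix.map_apply]
  by_cases h : i = j
  · subst h
    fin_cases s <;> fin_cases t <;> simp
  · simp [h]

/-- The permutation of pairs that permutes the pairs by `π` and the entries of the pairs by `ε`. -/
def pairPerm {k : ℕ} (x : Equiv.Perm (Fin k) × (Fin k → Equiv.Perm (Fin 2))) :
    Equiv.Perm (Fin k × Fin 2) :=
  Equiv.prodCongrLeft (fun _ => x.1) * Equiv.prodCongrRight x.2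

theorem pairPerm_apply {k : ℕ} (x : Equiv.Perm (Fin k) × (Fin k → Equiv.Perm (Fin 2)))
    (j : Fin k) (a : Fin 2) : pairPerm x (j, a) = (x.1 j, x.2 j a) := rfl

theorem pairPerm_injective {k : ℕ} : Function.Injective (pairPerm (k := k)) := by
  rintro ⟨π, ε⟩ ⟨π', ε'⟩ h
  have h1 : ∀ j a, (π j, ε j a) = (π' j, ε' j a) := fun j a => by
    simpa [pairPerm_apply] using DFunLike.congr_fun h (j, a)
  refine Prod.ext (Equiv.ext fun j => (Prod.ext_iff.1 (h1 j 0)).1) ?_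
  funext j
  exact Equiv.ext fun a => (Prod.ext_iff.1 (h1 j a)).2

/-- Only these permutations contribute to the Pfaffian of a matrix with 2 × 2 diagonal blocks. -/
theorem exists_pairPerm {k : ℕ} (s : Equiv.Perm (Fin k × Fin 2))
    (h : ∀ j, (s (j, 0)).1 = (s (j, 1)).1) : ∃ x, pairPerm x = s := by
  have h2 : ∀ j a, (s (j, a)).1 = (s (j, 0)).1 := by
    intro j a
    fin_cases a
    · rfl
    · exact (h j).symm
  have hε : ∀ j, Function.Injective fun a => (s (j, a)).2 := by
    intro j a a' haa
    have : s (j, a) = s (j, a') := Prod.ext ((h2 j a).trans (h2 j a').symm) haa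
    exact (Prod.ext_iff.1 (s.injective this)).2
  have hπ : Function.Injective fun j => (s (j, 0)).1 := by
    intro j j' hjj
    obtain ⟨a, ha⟩ := (Finite.injective_iff_surjective.1 (hε j)) (s (j', 0)).2
    have : s (j, a) = s (j', 0) := Prod.ext ((h2 j a).trans hjj) ha
    exact (Prod.ext_iff.1 (s.injective this)).1
  refine ⟨(Equiv.ofBijective _ (Finite.injective_iff_bijective.1 hπ),
    fun j => Equiv.ofBijective _ (Finite.injective_iff_bijective.1 (hε j))), ?_⟩
  ext1 ⟨j, a⟩
  rw [pairPerm_apply]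
  exact Prod.ext (h2 j a).symm rfl

/-- Permuting whole pairs is even, since the same permutation acts in both slots; a flip inside a
pair changes the sign of the permutation together with that of the entry. So each of the k!·2^k
permutations preserving the pairs contributes 1, which the normalization cancels. -/
theorem pfaffian_symp (k : ℕ) : pfaffian k (symp R k) = 1 := by
  have hterm : ∀ x : Equiv.Perm (Fin k) × (Fin k → Equiv.Perm (Fin 2)),
      ((Equiv.Perm.sign (pairPerm x) : ℤ) : R) *
        ∏ j : Fin k, symp R k (pairPerm x (j, 0)) (pairPerm x (j, 1)) = 1 := by
    rintro ⟨π, ε⟩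
    have hsign : ((Equiv.Perm.sign (pairPerm (π, ε)) : ℤ) : R) =
        ∏ j, ((Equiv.Perm.sign (ε j) : ℤ) : R) := by
      rw [pairPerm, Equiv.Perm.sign_mul, Equiv.Perm.sign_prodCongrLeft,
        Equiv.Perm.sign_prodCongrRight, Fin.prod_univ_two, Int.units_mul_self, one_mul]
      push_cast
      rfl
    rw [hsign, ← Finset.prod_mul_distrib]
    refine Finset.prod_eq_one fun j _ => ?_
    simp only [pairPerm_apply, symp, Matrix.of_apply, if_true]
    have h2 : ∀ τ : Equiv.Perm (Fin 2), ((Equiv.Perm.sign τ : ℤ)) *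
        (!![0, 1; -1, 0] : Matrix (Fin 2) (Fin 2) ℤ) (τ 0) (τ 1) = 1 := by decide
    have h3 : ∀ a b : Fin 2, (!![0, 1; -1, 0] : Matrix (Fin 2) (Fin 2) R) a b =
        (((!![0, 1; -1, 0] : Matrix (Fin 2) (Fin 2) ℤ) a b : ℤ) : R) := by
      intro a b
      fin_cases a <;> fin_cases b <;> simp
    refine (congrArg (_ * ·) (h3 (ε j 0) (ε j 1))).trans ?_
    rw [← Int.cast_mul, h2, Int.cast_one]
  have hsum : ∑ s : Equiv.Perm (Fin k × Fin 2), ((Equiv.Perm.sign s : ℤ) : R) *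
      ∏ j : Fin k, symp R k (s (j, 0)) (s (j, 1)) = ((k.factorial * 2 ^ k : ℕ) : R) := by
    have h1 : ∑ x : Equiv.Perm (Fin k) × (Fin k → Equiv.Perm (Fin 2)), (1 : R) =
        ((k.factorial * 2 ^ k : ℕ) : R) := by
      rw [Finset.sum_const, Finset.card_univ, nsmul_one, Fintype.card_prod, Fintype.card_perm,
        Fintype.card_pi, Fintype.card_fin]
      simp [Fintype.card_perm]
    rw [← h1]
    symm
    refine Finset.sum_of_injOn pairPerm pairPerm_injective.injOn
      (fun _ _ => Finset.mem_coe.2 (Finset.mem_univ _)) ?_ fun x _ => (hterm x).symm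
    intro s _ hs
    obtain ⟨j, hj⟩ : ∃ j, (s (j, 0)).1 ≠ (s (j, 1)).1 := by
      by_contra! hall
      obtain ⟨x, hx⟩ := exists_pairPerm s hall
      exact hs ⟨x, by simp, hx⟩
    rw [Finset.prod_eq_zero (Finset.mem_univ j), mul_zero]
    simp [symp, hj]
  rw [pfaffian, hsum, ← map_natCast (algebraMap ℂ R), ← map_mul]
  have : ((k.factorial : ℂ) * 2 ^ k) ≠ 0 :=
    mul_ne_zero (Nat.cast_ne_zero.2 (Nat.factorial_ne_zero k)) (by simp)
  have h2 : ((k.factorial * 2 ^ k : ℕ) : ℂ) = (k.factorial : ℂ) * 2 ^ k := by push_cast; rfl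
  rw [h2, one_div, inv_mul_cancel₀ this, map_one]

end Pfaffian

/-! ### The generating polynomial -/

section GenPoly

variable {R S : Type*} [CommRing R] [Algebra ℂ R] [CommRing S] [Algebra ℂ S]

theorem genPoly_map (b : Dyson) (k : ℕ) (φ : R →ₐ[ℂ] S)
    (G : Matrix (Fin k × Fin b.gamma) (Fin k × Fin b.gamma) R) :
    genPoly b k (G.map φ) = (genPoly b k G).map (φ : R →+* S) := by
  have hdet : ∀ {ι : Type} [Fintype ι] [DecidableEq ι] (G : Matrix ι ι R),
      (1 + (Polynomial.X : Polynomial S) • (G.map φ).map Polynomial.C).det =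
        ((1 + (Polynomial.X : Polynomial R) • G.map Polynomial.C).det).map (φ : R →+* S) := by
    intro ι _ _ G
    rw [← Polynomial.coe_mapRingHom, RingHom.map_det]
    congr 1
    ext1 i j
    simp [Matrix.one_apply, apply_ite]
  cases b
  · exact hdet G
  · exact hdet G
  · change pfaffian _ _ = Polynomial.mapAlgHom φ (pfaffian _ _)
    rw [← pfaffian_map]
    congr 1
    rw [Matrix.map_add _ (map_add _), symp_map]
    congr 1
    ext1 i j
    rw [← symp_map (Polynomial.mapAlgHom φ)]
    simp [Matrix.mul_apply, Polynomial.map_sum]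

theorem genPoly_smul (b : Dyson) (k : ℕ) (c : R)
    (G : Matrix (Fin k × Fin b.gamma) (Fin k × Fin b.gamma) R) :
    genPoly b k (c • G) = (genPoly b k G).comp (Polynomial.C c * Polynomial.X) := by
  have hdet : ∀ {ι : Type} [Fintype ι] [DecidableEq ι] (G : Matrix ι ι R),
      (1 + (Polynomial.X : Polynomial R) • (c • G).map Polynomial.C).det =
        ((1 + (Polynomial.X : Polynomial R) • G.map Polynomial.C).det).comp
          (Polynomial.C c * Polynomial.X) := by
    intro ι _ _ G
    rw [← Polynomial.coe_compRingHom_apply, RingHom.map_det]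
    congr 1
    ext1 i j
    by_cases h : i = j <;> simp [h] <;> ring
  cases b
  · exact hdet G
  · exact hdet G
  · have hψ : ∀ p : Polynomial R, p.comp (Polynomial.C c * Polynomial.X) =
        (Polynomial.aeval (Polynomial.C c * Polynomial.X)).restrictScalars ℂ p := fun p => by
      rw [Polynomial.comp_eq_aeval]; rfl
    change pfaffian k _ = (pfaffian k _ : Polynomial R).comp _
    rw [hψ, ← pfaffian_map]
    congr 1
    rw [Matrix.map_add _ (map_add _), symp_map]
    congr 1
    ext1 i j
    conv_rhs => rw [← symp_map (Polynomial.C : R →+* Polynomial R)]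
    conv_lhs => rw [← symp_map (Polynomial.C : R →+* Polynomial R)]
    simp [Matrix.mul_apply, Finset.mul_sum, map_sum]
    exact Finset.sum_congr rfl fun _ _ => by ring

theorem genPoly_diagonal (b : Dyson) (k : ℕ) (d : Fin k → R) :
    genPoly b k (Matrix.diagonal fun p => d p.1) =
      ∏ i, (1 + Polynomial.C (d i) * Polynomial.X) := by
  have hdet : (1 + (Polynomial.X : Polynomial R) •
        ((Matrix.diagonal fun p => d p.1 : Matrix (Fin k × Fin 1) (Fin k × Fin 1) R).map
          Polynomial.C)).det = ∏ i, (1 + Polynomial.C (d i) * Polynomial.X) := by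
    rw [Matrix.diagonal_map (map_zero _), ← Matrix.diagonal_smul, ← Matrix.diagonal_one,
      Matrix.diagonal_add, Matrix.det_diagonal, Fintype.prod_prod_type]
    refine Finset.prod_congr rfl fun i _ => ?_
    rw [Fin.prod_univ_one, mul_comm]
    rfl
  cases b
  · exact hdet
  · exact hdet
  -- The factor 1 + d_i μ is placed on the first entry of each pair only, so that the determinant
  -- contains it once.
  · have hW : symp (Polynomial R) k + (Polynomial.X : Polynomial R) • (symp (Polynomial R) k *
        (Matrix.diagonal fun p => d p.1 : Matrix (Fin k × Fin 2) (Fin k × Fin 2) R).map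
          Polynomial.C) =
        (Matrix.diagonal fun p : Fin k × Fin 2 => if p.2 = 0 then
          1 + Polynomial.C (d p.1) * Polynomial.X else 1).transpose * symp (Polynomial R) k *
        (Matrix.diagonal fun p : Fin k × Fin 2 => if p.2 = 0 then
          1 + Polynomial.C (d p.1) * Polynomial.X else 1) := by
      rw [Matrix.diagonal_map (map_zero _), Matrix.diagonal_transpose]
      ext1 ⟨i, s⟩ ⟨j, t⟩
      rw [Matrix.mul_diagonal, Matrix.diagonal_mul, Matrix.add_apply, Matrix.smul_apply,
        Matrix.mul_diagonal]
      by_cases h : i = j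
      · subst h
        fin_cases s <;> fin_cases t <;> simp [symp] <;> ring
      · simp [symp, h]
    change pfaffian _ _ = _
    rw [hW, pfaffian_transpose_mul_mul, pfaffian_symp, mul_one, Matrix.det_diagonal,
      Fintype.prod_prod_type]
    simp

/-- For β = 1, 2 this is similarity invariance of the determinant. For β = 4 the group condition
gives JV† = VᵀJ, so the argument of the Pfaffian becomes Vᵀ(J + μJG)V; and VᵀJV = J forces det V = 1
by taking Pfaffians. -/
theorem genPoly_conj (b : Dyson) (k : ℕ) (V : unitaryGrp b k)
    (G : Matrix (Fin k × Fin b.gamma) (Fin k × Fin b.gamma) ℂ) :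
    genPoly b k (V.1.1.conjTranspose * G * V.1.1) = genPoly b k G := by
  have hV : V.1.1.conjTranspose * V.1.1 = 1 := Matrix.mem_unitaryGroup_iff'.1 V.1.2
  have hdet : ∀ {ι : Type} [Fintype ι] [DecidableEq ι] (G V : Matrix ι ι ℂ),
      V.conjTranspose * V = 1 →
      (1 + (Polynomial.X : Polynomial ℂ) • (V.conjTranspose * G * V).map Polynomial.C).det =
        (1 + (Polynomial.X : Polynomial ℂ) • G.map Polynomial.C).det := by
    intro ι _ _ G V hV
    have h1 : (V.conjTranspose.map Polynomial.C) * V.map Polynomial.C =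
        (1 : Matrix ι ι (Polynomial ℂ)) := by
      rw [← Matrix.map_mul, hV, Matrix.map_one _ (map_zero _) (map_one _)]
    have h2 : 1 + (Polynomial.X : Polynomial ℂ) • (V.conjTranspose * G * V).map Polynomial.C =
        V.conjTranspose.map Polynomial.C * ((1 + (Polynomial.X : Polynomial ℂ) •
          G.map Polynomial.C) * V.map Polynomial.C) := by
      rw [Matrix.map_mul, Matrix.map_mul, Matrix.add_mul, Matrix.mul_add, Matrix.one_mul, h1,
        Matrix.smul_mul, Matrix.mul_smul, Matrix.mul_assoc]
    rw [h2, Matrix.det_mul, mul_comm, ← Matrix.det_mul, Matrix.mul_assoc, mul_eq_one_comm.1 h1,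
      Matrix.mul_one]
  cases b
  · exact hdet G V.1.1 hV
  · exact hdet G V.1.1 hV
  · have hJ : V.1.1.map star * symp ℂ k = symp ℂ k * V.1.1 := V.2 (by simp)
    have hJ2 : symp ℂ k * V.1.1.conjTranspose = V.1.1.transpose * symp ℂ k := by
      have := congrArg Matrix.transpose hJ
      rw [Matrix.transpose_mul, Matrix.transpose_mul, symp_transpose, Matrix.neg_mul,
        Matrix.mul_neg, neg_inj] at this
      exact this
    have hJ3 : V.1.1.transpose * symp ℂ k * V.1.1 = symp ℂ k := by
      rw [← hJ2, Matrix.mul_assoc, hV, Matrix.mul_one]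
    have hd : (V.1.1).det = 1 := by
      have := pfaffian_transpose_mul_mul k V.1.1 (symp ℂ k)
      rw [hJ3, pfaffian_symp, mul_one] at this
      exact this.symm
    have h2 : symp (Polynomial ℂ) k + (Polynomial.X : Polynomial ℂ) • (symp (Polynomial ℂ) k *
        (V.1.1.conjTranspose * G * V.1.1).map Polynomial.C) =
        (V.1.1.map Polynomial.C).transpose * (symp (Polynomial ℂ) k +
          (Polynomial.X : Polynomial ℂ) • (symp (Polynomial ℂ) k * G.map Polynomial.C)) *
            V.1.1.map Polynomial.C := by
      rw [← symp_map (Polynomial.C : ℂ →+* Polynomial ℂ), ← Matrix.map_mul, ← Matrix.map_mul,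
        ← Matrix.transpose_map, Matrix.mul_add, Matrix.add_mul, Matrix.mul_smul, Matrix.smul_mul,
        ← Matrix.map_mul, ← Matrix.map_mul, ← Matrix.map_mul, ← Matrix.map_mul, hJ3,
        ← Matrix.mul_assoc (Matrix.transpose _), ← hJ2]
      simp only [Matrix.mul_assoc]
    change pfaffian _ _ = pfaffian _ _
    refine (congrArg (pfaffian k) h2).trans ?_
    rw [pfaffian_transpose_mul_mul, ← RingHom.mapMatrix_apply, ← RingHom.map_det, hd, map_one,
      one_mul]

end GenPoly

/-! ### Matrices over the number field -/

/-- The complex matrix `M` is a matrix over the number field. -/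
def IsFieldMat (b : Dyson) {p q : ℕ} (M : Matrix (Fin p × Fin b.gamma) (Fin q × Fin b.gamma) ℂ) :
    Prop :=
  b ≠ .complex → M.map star * structMat b q = structMat b p * M

section FieldMat

variable {b : Dyson} {p q r : ℕ}

theorem IsFieldMat.mul {M : Matrix (Fin p × Fin b.gamma) (Fin q × Fin b.gamma) ℂ}
    {N : Matrix (Fin q × Fin b.gamma) (Fin r × Fin b.gamma) ℂ} (hM : IsFieldMat b M)
    (hN : IsFieldMat b N) : IsFieldMat b (M * N) := fun hb => by
  have hmap : (M * N).map star = M.map star * N.map star := Matrix.map_mul (f := starRingEnd ℂ)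
  rw [hmap, Matrix.mul_assoc, hN hb, ← Matrix.mul_assoc, hM hb, Matrix.mul_assoc]

theorem IsFieldMat.add {M N : Matrix (Fin p × Fin b.gamma) (Fin q × Fin b.gamma) ℂ}
    (hM : IsFieldMat b M) (hN : IsFieldMat b N) : IsFieldMat b (M + N) := fun hb => by
  rw [Matrix.map_add _ (star_add), Matrix.add_mul, hM hb, hN hb, Matrix.mul_add]

theorem IsFieldMat.sub {M N : Matrix (Fin p × Fin b.gamma) (Fin q × Fin b.gamma) ℂ}
    (hM : IsFieldMat b M) (hN : IsFieldMat b N) : IsFieldMat b (M - N) := fun hb => by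
  rw [Matrix.map_sub _ (star_sub), Matrix.sub_mul, hM hb, hN hb, Matrix.mul_sub]

theorem IsFieldMat.conjTranspose {M : Matrix (Fin p × Fin b.gamma) (Fin q × Fin b.gamma) ℂ}
    (hM : IsFieldMat b M) : IsFieldMat b M.conjTranspose := by
  intro hb
  have h := congrArg Matrix.conjTranspose (hM hb)
  rw [Matrix.conjTranspose_mul, Matrix.conjTranspose_mul] at h
  have hstar : (M.map star).conjTranspose = M.conjTranspose.map star := rfl
  rw [hstar] at h
  cases b
  · simpa [structMat] using h
  · exact absurd rfl hb
  · have hJ : ∀ l, (symp ℂ l).conjTranspose = -symp ℂ l := by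
      intro l
      rw [← symp_transpose, Matrix.conjTranspose, Matrix.transpose_map]
      congr 1
      exact symp_map (starRingEnd ℂ) l
    have key : ∀ N : Matrix (Fin q × Fin 2) (Fin p × Fin 2) ℂ,
        (symp ℂ q).conjTranspose * N.map star = N * (symp ℂ p).conjTranspose →
          N.map star * symp ℂ p = symp ℂ q * N := by
      intro N hN
      rw [hJ, hJ, Matrix.neg_mul, Matrix.mul_neg, neg_inj] at hN
      have h2 := congrArg (fun X => symp ℂ q * X * symp ℂ p) hN
      simp only [Matrix.mul_assoc, symp_mul_self] at h2
      rw [← Matrix.mul_assoc, symp_mul_self] at h2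
      simpa using h2
    exact key _ h

theorem isFieldMat_real_iff {M : Matrix (Fin p × Fin 1) (Fin q × Fin 1) ℂ} :
    IsFieldMat .real M ↔ ∀ i j, star (M i j) = M i j := by
  rw [IsFieldMat]
  simp only [ne_eq, reduceCtorEq, not_false_eq_true, forall_const]
  change M.map star * 1 = 1 * M ↔ _
  rw [Matrix.mul_one, Matrix.one_mul, ← Matrix.ext_iff]
  rfl

theorem isFieldMat_quaternion_iff {M : Matrix (Fin p × Fin 2) (Fin q × Fin 2) ℂ} :
    IsFieldMat .quaternion M ↔ ∀ i j, M (i, 1) (j, 0) = -star (M (i, 0) (j, 1)) ∧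
      M (i, 1) (j, 1) = star (M (i, 0) (j, 0)) := by
  have h1 : ∀ i s j, (M.map star * symp ℂ q) (i, s) (j, 0) = -star (M (i, s) (j, 1)) ∧
      (M.map star * symp ℂ q) (i, s) (j, 1) = star (M (i, s) (j, 0)) := by
    intro i s j
    simp [Matrix.mul_apply, Fintype.sum_prod_type, symp]
  have h2 : ∀ i j t, (symp ℂ p * M) (i, 0) (j, t) = M (i, 1) (j, t) ∧
      (symp ℂ p * M) (i, 1) (j, t) = -M (i, 0) (j, t) := by
    intro i j t
    simp [Matrix.mul_apply, Fintype.sum_prod_type, symp]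
  rw [IsFieldMat]
  simp only [ne_eq, reduceCtorEq, not_false_eq_true, forall_const]
  change M.map star * symp ℂ q = symp ℂ p * M ↔ _
  constructor
  · intro h i j
    rw [← (h2 i j 0).1, ← (h2 i j 1).1, ← h, (h1 i 0 j).1, (h1 i 0 j).2]
    exact ⟨rfl, rfl⟩
  · intro h
    ext1 ⟨i, s⟩ ⟨j, t⟩
    obtain ⟨h3, h4⟩ := h i j
    fin_cases s <;> fin_cases t
    · exact (h1 i 0 j).1.trans (h3.symm.trans (h2 i j 0).1.symm)
    · exact (h1 i 0 j).2.trans (h4.symm.trans (h2 i j 1).1.symm)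
    · refine (h1 i 1 j).1.trans (Eq.trans ?_ (h2 i j 0).2.symm)
      rw [h4, star_star]
    · refine (h1 i 1 j).2.trans (Eq.trans ?_ (h2 i j 1).2.symm)
      rw [h3, star_neg, star_star]

theorem toMat_real_apply {n m : ℕ} (A : Gl .real n m) (i j) (s t : Fin 1) :
    toMat A (i, s) (j, t) = A (i, j, 0) := by
  fin_cases s; fin_cases t
  simp [toMat, mat, basisMat]

theorem toMat_complex_apply {n m : ℕ} (A : Gl .complex n m) (i j) (s t : Fin 1) :
    toMat A (i, s) (j, t) = A (i, j, 0) + Complex.I * A (i, j, 1) := by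
  fin_cases s; fin_cases t
  simp [toMat, mat, basisMat, Fin.sum_univ_two]

theorem toMat_quaternion_apply {n m : ℕ} (A : Gl .quaternion n m) (i j) :
    toMat A (i, (0 : Fin 2)) (j, (0 : Fin 2)) = A (i, j, 0) + Complex.I * A (i, j, 1) ∧
    toMat A (i, (0 : Fin 2)) (j, (1 : Fin 2)) = A (i, j, 2) + Complex.I * A (i, j, 3) ∧
    toMat A (i, (1 : Fin 2)) (j, (0 : Fin 2)) = -A (i, j, 2) + Complex.I * A (i, j, 3) ∧
    toMat A (i, (1 : Fin 2)) (j, (1 : Fin 2)) = A (i, j, 0) - Complex.I * A (i, j, 1) := by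
  simp [toMat, mat, basisMat, Fin.sum_univ_four]
  ring

theorem isFieldMat_toMat {n m : ℕ} (A : Gl b n m) : IsFieldMat b (toMat A) := by
  cases b
  · refine isFieldMat_real_iff.2 ?_
    rintro ⟨i, s⟩ ⟨j, t⟩
    rw [toMat_real_apply]
    exact Complex.conj_ofReal _
  · exact fun h => absurd rfl h
  · refine isFieldMat_quaternion_iff.2 fun i j => ?_
    obtain ⟨h1, h2, h3, h4⟩ := toMat_quaternion_apply A i j
    rw [h1, h2, h3, h4]
    simp [sub_eq_add_neg, add_comm]

/-- The real coordinates of a matrix over the number field. -/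
def ofMat {n m : ℕ} (M : Matrix (Fin n × Fin b.gamma) (Fin (n - m) × Fin b.gamma) ℂ) : Gl b n m :=
  fun a => coords b (Matrix.of fun s t => M (a.1, s) (a.2.1, t)) a.2.2

/-- `coords` reads only the first row of a block; the hypothesis supplies what it omits. -/
theorem toMat_ofMat {n m : ℕ} {M : Matrix (Fin n × Fin b.gamma) (Fin (n - m) × Fin b.gamma) ℂ}
    (hM : IsFieldMat b M) : toMat (ofMat M) = M := by
  cases b
  · ext1 ⟨i, s⟩ ⟨j, t⟩
    rw [toMat_real_apply]
    fin_cases s; fin_cases t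
    exact Complex.conj_eq_iff_re.1 (isFieldMat_real_iff.1 hM _ _)
  · ext1 ⟨i, s⟩ ⟨j, t⟩
    rw [toMat_complex_apply]
    fin_cases s; fin_cases t
    refine Eq.trans ?_ (Complex.re_add_im _)
    rw [mul_comm]
    rfl
  · ext1 ⟨i, s⟩ ⟨j, t⟩
    obtain ⟨h1, h2, h3, h4⟩ := toMat_quaternion_apply (ofMat M) i j
    obtain ⟨h5, h6⟩ := isFieldMat_quaternion_iff.1 hM i j
    have h7 := Complex.re_add_im (M (i, (0 : Fin 2)) (j, (0 : Fin 2)))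
    have h8 := Complex.re_add_im (M (i, (0 : Fin 2)) (j, (1 : Fin 2)))
    have e0 : ofMat M (i, j, 0) = (M (i, (0 : Fin 2)) (j, (0 : Fin 2))).re := rfl
    have e1 : ofMat M (i, j, 1) = (M (i, (0 : Fin 2)) (j, (0 : Fin 2))).im := rfl
    have e2 : ofMat M (i, j, 2) = (M (i, (0 : Fin 2)) (j, (1 : Fin 2))).re := rfl
    have e3 : ofMat M (i, j, 3) = (M (i, (0 : Fin 2)) (j, (1 : Fin 2))).im := rfl
    rw [e0, e1] at h1 h4
    rw [e2, e3] at h2 h3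
    fin_cases s <;> fin_cases t
    · exact h1.trans (by rw [mul_comm]; exact h7)
    · exact h2.trans (by rw [mul_comm]; exact h8)
    · refine h3.trans (Eq.trans ?_ h5.symm)
      rw [← h8]
      simp [mul_comm, add_comm]
    · refine h4.trans (Eq.trans ?_ h6.symm)
      rw [← h7]
      simp [mul_comm, sub_eq_add_neg]

theorem ofMat_toMat {n m : ℕ} (A : Gl b n m) : ofMat (toMat A) = A := by
  funext ⟨i, j, c⟩
  cases b
  · fin_cases c
    change (toMat A (i, (0 : Fin 1)) (j, (0 : Fin 1))).re = _
    rw [toMat_real_apply]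
    simp
  · fin_cases c
    · change (toMat A (i, (0 : Fin 1)) (j, (0 : Fin 1))).re = _
      rw [toMat_complex_apply]
      simp
    · change (toMat A (i, (0 : Fin 1)) (j, (0 : Fin 1))).im = _
      rw [toMat_complex_apply]
      simp
  · obtain ⟨h1, h2, -, -⟩ := toMat_quaternion_apply A i j
    fin_cases c
    · change (toMat A (i, (0 : Fin 2)) (j, (0 : Fin 2))).re = _
      rw [h1]; simp
    · change (toMat A (i, (0 : Fin 2)) (j, (0 : Fin 2))).im = _
      rw [h1]; simp
    · change (toMat A (i, (0 : Fin 2)) (j, (1 : Fin 2))).re = _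
      rw [h2]; simp; rfl
    · change (toMat A (i, (0 : Fin 2)) (j, (1 : Fin 2))).im = _
      rw [h2]; simp; rfl

theorem toMat_injective {n m : ℕ} : Function.Injective (toMat : Gl b n m → _) :=
  Function.LeftInverse.injective ofMat_toMat

theorem continuous_ofMat {n m : ℕ} : Continuous (ofMat (b := b) (n := n) (m := m)) := by
  refine continuous_pi fun ⟨i, j, c⟩ => ?_
  have hentry : ∀ x y, Continuous
      fun M : Matrix (Fin n × Fin b.gamma) (Fin (n - m) × Fin b.gamma) ℂ => M x y :=
    fun x y => continuous_id.matrix_elem x y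
  cases b
  · fin_cases c
    exact Complex.continuous_re.comp (hentry _ _)
  · fin_cases c
    · exact Complex.continuous_re.comp (hentry _ _)
    · exact Complex.continuous_im.comp (hentry _ _)
  · fin_cases c
    · exact Complex.continuous_re.comp (hentry _ _)
    · exact Complex.continuous_im.comp (hentry _ _)
    · exact Complex.continuous_re.comp (hentry _ _)
    · exact Complex.continuous_im.comp (hentry _ _)

/-- A real matrix as a matrix over the number field. -/
def realMat (b : Dyson) (R : Matrix (Fin p) (Fin q) ℝ) :
    Matrix (Fin p × Fin b.gamma) (Fin q × Fin b.gamma) ℂ :=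
  Matrix.kroneckerMap (· * ·) (R.map (↑)) 1

theorem realMat_apply (R : Matrix (Fin p) (Fin q) ℝ) (i j s t) :
    realMat b R (i, s) (j, t) = if s = t then (R i j : ℂ) else 0 := by
  simp [realMat, Matrix.one_apply]

theorem realMat_mul (R : Matrix (Fin p) (Fin q) ℝ) (S : Matrix (Fin q) (Fin r) ℝ) :
    realMat b (R * S) = realMat b R * realMat b S := by
  rw [realMat, realMat, realMat, ← Matrix.mul_kronecker_mul, Matrix.mul_one]
  congr 1
  exact Matrix.map_mul (f := Complex.ofRealHom)

theorem realMat_one : realMat b (1 : Matrix (Fin p) (Fin p) ℝ) = 1 := by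
  rw [realMat, Matrix.map_one _ Complex.ofReal_zero Complex.ofReal_one]
  exact Matrix.one_kronecker_one

theorem conjTranspose_realMat (R : Matrix (Fin p) (Fin q) ℝ) :
    (realMat b R).conjTranspose = realMat b R.transpose := by
  ext ⟨i, s⟩ ⟨j, t⟩
  rw [Matrix.conjTranspose_apply, realMat_apply, realMat_apply]
  by_cases h : s = t
  · simp [h]
  · simp [h, Ne.symm h]

theorem isFieldMat_realMat (R : Matrix (Fin p) (Fin q) ℝ) : IsFieldMat b (realMat b R) := by
  cases b
  · refine isFieldMat_real_iff.2 ?_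
    rintro ⟨i, s⟩ ⟨j, t⟩
    rw [realMat_apply]
    split_ifs <;> simp
  · exact fun h => absurd rfl h
  · refine isFieldMat_quaternion_iff.2 fun i j => ?_
    refine ⟨?_, ?_⟩
    · refine (realMat_apply R i j _ _).trans (Eq.trans ?_
        (congrArg (fun z => -star z) (realMat_apply R i j _ _).symm))
      simp
    · refine (realMat_apply R i j _ _).trans (Eq.trans ?_
        (congrArg star (realMat_apply R i j _ _).symm))
      simp

/-- The matrices `basisMat` are orthogonal for Re tr X†Y, each with squared norm γ. This reduces the
kernel of `psiHat` to a plane wave in the real coordinates. -/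
theorem trace_pairing {n m : ℕ} (B A : Gl b n m) :
    ((toMat B).conjTranspose * toMat A).trace + ((toMat A).conjTranspose * toMat B).trace =
      2 * (b.gamma : ℂ) * ((B ⬝ᵥ A : ℝ) : ℂ) := by
  have htr : ∀ M N : Matrix (Fin n × Fin b.gamma) (Fin (n - m) × Fin b.gamma) ℂ,
      (M.conjTranspose * N).trace =
        ∑ i, ∑ j, ∑ s, ∑ t, star (M (i, s) (j, t)) * N (i, s) (j, t) := by
    intro M N
    simp only [Matrix.trace, Matrix.diag_apply, Matrix.mul_apply, Matrix.conjTranspose_apply]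
    rw [Finset.sum_comm]
    simp only [Fintype.sum_prod_type]
    refine Finset.sum_congr rfl fun i _ => ?_
    rw [Finset.sum_comm]
  rw [htr, htr, dotProduct, Complex.ofReal_sum]
  simp only [Fintype.sum_prod_type, Finset.mul_sum, ← Finset.sum_add_distrib]
  refine Finset.sum_congr rfl fun i _ => Finset.sum_congr rfl fun j _ => ?_
  cases b
  · simp only [Fin.sum_univ_one]
    rw [toMat_real_apply, toMat_real_apply]
    simp
    ring
  · simp only [Fin.sum_univ_one, Fin.sum_univ_two]
    rw [toMat_complex_apply, toMat_complex_apply]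
    simp
    ring_nf
    simp
  · obtain ⟨h1, h2, h3, h4⟩ := toMat_quaternion_apply A i j
    obtain ⟨h5, h6, h7, h8⟩ := toMat_quaternion_apply B i j
    simp only [Fin.sum_univ_two, Fin.sum_univ_four]
    rw [h1, h2, h3, h4, h5, h6, h7, h8]
    simp
    ring_nf
    simp
    ring

end FieldMat

/-! ### The action of the groups -/

section Action

variable {b : Dyson} {n m : ℕ}

/-- The first `n - m` columns of the unit matrix. -/
def baseFrame (n m : ℕ) : Matrix (Fin n) (Fin (n - m)) ℝ :=
  Matrix.of fun i j => if i = Fin.castLE (Nat.sub_le n m) j then 1 else 0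

theorem baseFrame_transpose_mul_self (n m : ℕ) : (baseFrame n m).transpose * baseFrame n m = 1 := by
  ext i j
  simp [Matrix.mul_apply, baseFrame, Matrix.one_apply, eq_comm]

theorem frame_eq_ofMat (U : unitaryGrp b n) :
    frame b n m U = ofMat (U.1.1 * realMat b (baseFrame n m)) := by
  funext a
  simp only [frame, ofMat]
  congr 2
  ext s t
  simp only [Matrix.mul_apply, Fintype.sum_prod_type, realMat_apply, baseFrame, Matrix.of_apply]
  simp [apply_ite]

theorem toMat_frame (U : unitaryGrp b n) :
    toMat (frame b n m U) = U.1.1 * realMat b (baseFrame n m) := by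
  rw [frame_eq_ofMat]
  exact toMat_ofMat (IsFieldMat.mul U.2 (isFieldMat_realMat _))

theorem conjTranspose_mul_self (U : unitaryGrp b n) : U.1.1.conjTranspose * U.1.1 = 1 :=
  Matrix.mem_unitaryGroup_iff'.1 U.1.2

theorem frame_mem_stiefel (U : unitaryGrp b n) : frame b n m U ∈ stiefel b n m := by
  rw [stiefel, Set.mem_ofPred_eq, toMat_frame, Matrix.conjTranspose_mul, Matrix.mul_assoc,
    ← Matrix.mul_assoc _ U.1.1, conjTranspose_mul_self, Matrix.one_mul, conjTranspose_realMat,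
    ← realMat_mul, baseFrame_transpose_mul_self, realMat_one]

/-- Every group element of size `n - m` extends to one of size `n` that acts by it on the base frame. -/
theorem exists_extend (V : unitaryGrp b (n - m)) : ∃ W : unitaryGrp b n,
    W.1.1 * realMat b (baseFrame n m) = realMat b (baseFrame n m) * V.1.1 := by
  set E := realMat b (baseFrame n m) with hE
  have hEE : E.conjTranspose * E = 1 := by
    rw [hE, conjTranspose_realMat, ← realMat_mul, baseFrame_transpose_mul_self, realMat_one]
  have hEf : IsFieldMat b E := isFieldMat_realMat _
  -- `P` projects onto the orthogonal complement of the range of `E`; `W` below acts as `V` on that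
  -- range and as the identity on the complement.
  set P := 1 - E * E.conjTranspose with hP
  have hPE : P * E = 0 := by
    rw [hP, Matrix.sub_mul, Matrix.mul_assoc, hEE]; simp
  have hPc : P.conjTranspose = P := by
    simp [hP]
  have hEP : E.conjTranspose * P = 0 := by
    rw [hP, Matrix.mul_sub, ← Matrix.mul_assoc, hEE]; simp
  have hPP : P * P = P := by
    conv_lhs => rw [hP, Matrix.sub_mul, Matrix.mul_assoc, ← hP, hEP]
    simp
  have hf1 : IsFieldMat b (1 : Matrix (Fin n × Fin b.gamma) (Fin n × Fin b.gamma) ℂ) := by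
    rw [← realMat_one]; exact isFieldMat_realMat _
  let W := E * V.1.1 * E.conjTranspose + P
  have hWu : W ∈ Matrix.unitaryGroup (Fin n × Fin b.gamma) ℂ := by
    rw [Matrix.mem_unitaryGroup_iff', Matrix.star_eq_conjTranspose]
    have hWc : W.conjTranspose = E * V.1.1.conjTranspose * E.conjTranspose + P := by
      simp only [W, Matrix.conjTranspose_add, Matrix.conjTranspose_mul, hPc,
        Matrix.conjTranspose_conjTranspose, Matrix.mul_assoc]
    calc W.conjTranspose * W
        = E * (V.1.1.conjTranspose * (E.conjTranspose * E) * V.1.1) * E.conjTranspose +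
            E * V.1.1.conjTranspose * (E.conjTranspose * P) +
            (P * E) * V.1.1 * E.conjTranspose + P * P := by
          rw [hWc]
          simp only [W, Matrix.add_mul, Matrix.mul_add, Matrix.mul_assoc]
          abel
      _ = 1 := by
          rw [hEE, hEP, hPE, hPP, Matrix.mul_one, conjTranspose_mul_self]
          simp [hP]
  refine ⟨⟨⟨W, hWu⟩, ?_⟩, ?_⟩
  · exact ((hEf.mul V.2).mul hEf.conjTranspose).add (hf1.sub (hEf.mul hEf.conjTranspose))
  · change W * E = _
    simp only [W]
    rw [Matrix.add_mul, hPE, Matrix.mul_assoc, hEE, Matrix.mul_one, add_zero]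

/-- The two-sided action of the groups on the matrices. -/
def act (U : unitaryGrp b n) (V : unitaryGrp b (n - m)) (B : Gl b n m) : Gl b n m :=
  ofMat (U.1.1 * toMat B * V.1.1)

theorem toMat_act (U : unitaryGrp b n) (V : unitaryGrp b (n - m)) (B : Gl b n m) :
    toMat (act U V B) = U.1.1 * toMat B * V.1.1 :=
  toMat_ofMat ((IsFieldMat.mul U.2 (isFieldMat_toMat B)).mul V.2)

theorem continuous_frame : Continuous (frame b n m) := by
  rw [funext fun U => frame_eq_ofMat (b := b) (n := n) (m := m) U]
  exact continuous_ofMat.comp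
    ((continuous_subtype_val.comp continuous_subtype_val).matrix_mul continuous_const)

/-- With E the base frame, (UBV)·(gE) = B·(U†gEV†), and EV† = WE for an extension W of V⁻¹. Both
factors thus become translations of the group variable g. -/
theorem dotProduct_act (U : unitaryGrp b n) (V : unitaryGrp b (n - m)) (B : Gl b n m) :
    ∃ W : unitaryGrp b n, ∀ g, act U V B ⬝ᵥ frame b n m g = B ⬝ᵥ frame b n m (U⁻¹ * g * W) := by
  obtain ⟨W, hW⟩ := exists_extend (n := n) (m := m) V⁻¹
  refine ⟨W, fun g => ?_⟩
  have hγ : (2 * (b.gamma : ℂ)) ≠ 0 := by cases b <;> simp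
  apply Complex.ofReal_injective
  apply mul_left_cancel₀ hγ
  have hU : (U⁻¹).1.1 = U.1.1.conjTranspose := rfl
  have hV : (V⁻¹).1.1 = V.1.1.conjTranspose := rfl
  have hframe : toMat (frame b n m (U⁻¹ * g * W)) =
      U.1.1.conjTranspose * toMat (frame b n m g) * V.1.1.conjTranspose := by
    rw [toMat_frame, toMat_frame]
    change U.1.1.conjTranspose * g.1.1 * W.1.1 * realMat b (baseFrame n m) =
      U.1.1.conjTranspose * (g.1.1 * realMat b (baseFrame n m)) * V.1.1.conjTranspose
    rw [Matrix.mul_assoc _ W.1.1, hW, hV]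
    simp only [Matrix.mul_assoc]
  rw [← trace_pairing, ← trace_pairing, hframe, toMat_act]
  congr 1
  · simp only [Matrix.conjTranspose_mul, Matrix.mul_assoc]
    rw [Matrix.trace_mul_comm]
    simp only [Matrix.mul_assoc]
  · simp only [Matrix.conjTranspose_mul, Matrix.mul_assoc, Matrix.conjTranspose_conjTranspose]
    rw [Matrix.trace_mul_comm V.1.1]
    simp only [Matrix.mul_assoc]

/-- The normalized Haar measure. -/
abbrev groupMeasure (b : Dyson) (n : ℕ) : Measure (unitaryGrp b n) :=
  Measure.haarMeasure (⊤ : TopologicalSpace.PositiveCompacts (unitaryGrp b n))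

instance : IsProbabilityMeasure (groupMeasure b n) :=
  ⟨by
    rw [← TopologicalSpace.PositiveCompacts.coe_top]
    exact Measure.haarMeasure_self⟩

/-- Compact groups are unimodular: a right translate is again a Haar probability measure, and there
is only one. -/
instance : (groupMeasure b n).IsMulRightInvariant where
  map_mul_right_eq_self g := by
    have : IsProbabilityMeasure ((groupMeasure b n).map (· * g)) :=
      Measure.isProbabilityMeasure_map (continuous_mul_const g).aemeasurable
    have : ((groupMeasure b n).map (· * g)).IsHaarMeasure :=
      Measure.isHaarMeasure_map_mul_right _ g
    exact Measure.isHaarMeasure_eq_of_isProbabilityMeasure _ _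

instance : IsProbabilityMeasure (stiefelMeasure b n m) :=
  Measure.isProbabilityMeasure_map continuous_frame.aemeasurable

theorem integral_stiefelMeasure {f : Gl b n m → ℂ} (hf : Continuous f) :
    ∫ A, f A ∂(stiefelMeasure b n m) = ∫ g, f (frame b n m g) ∂(groupMeasure b n) :=
  integral_map continuous_frame.aemeasurable hf.aestronglyMeasurable

theorem integral_act {h : ℝ → ℂ} (hh : Continuous h) (U : unitaryGrp b n)
    (V : unitaryGrp b (n - m)) (B : Gl b n m) :
    ∫ A, h (act U V B ⬝ᵥ A) ∂(stiefelMeasure b n m) =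
      ∫ A, h (B ⬝ᵥ A) ∂(stiefelMeasure b n m) := by
  have hc : ∀ B : Gl b n m, Continuous fun A : Gl b n m => h (B ⬝ᵥ A) := fun B =>
    hh.comp (continuous_const.dotProduct continuous_id)
  rw [integral_stiefelMeasure (hc _), integral_stiefelMeasure (hc _)]
  obtain ⟨W, hW⟩ := dotProduct_act U V B
  simp only [hW]
  rw [integral_mul_left_eq_self (μ := groupMeasure b n)
      (fun g => h (B ⬝ᵥ frame b n m (g * W))) U⁻¹,
    integral_mul_right_eq_self (fun g => h (B ⬝ᵥ frame b n m g)) W]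

end Action

/-! ### Singular values -/

section SingularValues

variable {b : Dyson} {p n m : ℕ}

theorem isUnit_structMat : IsUnit (structMat b p) := by
  cases b
  · exact isUnit_one
  · exact isUnit_one
  · have h : symp ℂ p * -symp ℂ p = 1 := by rw [mul_neg, symp_mul_self, neg_neg]
    exact IsUnit.of_mul_eq_one _ h

/-- The condition says that the entrywise conjugate of Y is its conjugate by the structure matrix,
and both operations commute with exp. -/
theorem IsFieldMat.exp {Y : Matrix (Fin p × Fin b.gamma) (Fin p × Fin b.gamma) ℂ}
    (hY : IsFieldMat b Y) : IsFieldMat b (NormedSpace.exp Y) := by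
  intro hb
  have hdet : IsUnit (structMat b p).det :=
    (Matrix.isUnit_iff_isUnit_det _).1 isUnit_structMat
  have hstar : (NormedSpace.exp Y).map star = NormedSpace.exp (Y.map star) := by
    change (NormedSpace.exp Y).conjTranspose.transpose = NormedSpace.exp Y.conjTranspose.transpose
    rw [Matrix.exp_transpose, Matrix.exp_conjTranspose]
  have hconj : Y.map star = structMat b p * Y * (structMat b p)⁻¹ := by
    rw [← hY hb, Matrix.mul_assoc, Matrix.mul_nonsing_inv _ hdet, Matrix.mul_one]
  rw [hstar, hconj, Matrix.exp_conj _ _ isUnit_structMat, Matrix.mul_assoc,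
    Matrix.nonsing_inv_mul _ hdet, Matrix.mul_one]

theorem exp_mem_unitaryGroup {Y : Matrix (Fin p × Fin b.gamma) (Fin p × Fin b.gamma) ℂ}
    (hY : Y.conjTranspose = -Y) :
    NormedSpace.exp Y ∈ Matrix.unitaryGroup (Fin p × Fin b.gamma) ℂ := by
  rw [Matrix.mem_unitaryGroup_iff', Matrix.star_eq_conjTranspose, ← Matrix.exp_conjTranspose, hY,
    Matrix.exp_neg, Matrix.nonsing_inv_mul _
      ((Matrix.isUnit_iff_isUnit_det _).1 (Matrix.isUnit_exp Y))]

theorem hasDerivAt_re_trace_exp {ι : Type*} [Fintype ι] [DecidableEq ι] (X N : Matrix ι ι ℂ) :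
    HasDerivAt (fun t : ℝ => (NormedSpace.exp (t • X) * N).trace.re) (X * N).trace.re 0 := by
  let _ : NormedRing (Matrix ι ι ℂ) := Matrix.linftyOpNormedRing
  let _ : NormedAlgebra ℝ (Matrix ι ι ℂ) := Matrix.linftyOpNormedAlgebra
  let T : Matrix ι ι ℂ →ₗ[ℝ] ℝ :=
    Complex.reLm ∘ₗ ((Matrix.traceLinearMap ι ℂ ℂ).restrictScalars ℝ) ∘ₗ
      LinearMap.mulRight ℝ N
  have h := (LinearMap.toContinuousLinearMap T).hasFDerivAt.comp_hasDerivAt (0 : ℝ)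
    (hasDerivAt_exp_smul_const (𝕂 := ℝ) X 0)
  rw [zero_smul, NormedSpace.exp_zero, one_mul] at h
  exact h

-- First-order condition at W = 1 along exp(tX) with the skew-Hermitian X = N† - N: it gives Re tr
-- N†N = Re tr N², hence tr X†X = 2 tr N†N - 2 Re tr N² = 0.
open scoped ComplexOrder in
theorem isHermitian_of_trace_le {N : Matrix (Fin p × Fin b.gamma) (Fin p × Fin b.gamma) ℂ}
    (hN : IsFieldMat b N)
    (hmax : ∀ W : unitaryGrp b p, (W.1.1 * N).trace.re ≤ N.trace.re) : N.conjTranspose = N := by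
  set X := N.conjTranspose - N with hX
  have hXc : X.conjTranspose = -X := by simp [hX]
  have hXf : IsFieldMat b X := hN.conjTranspose.sub hN
  have hsmul : ∀ t : ℝ, IsFieldMat b (t • X) := by
    intro t hb
    have : (t • X).map star = t • X.map star := by
      ext i j
      simp
    rw [this, Matrix.smul_mul, hXf hb, Matrix.mul_smul]
  have hloc : IsLocalMax (fun t : ℝ => (NormedSpace.exp (t • X) * N).trace.re) 0 := by
    refine Eventually.of_forall fun t => ?_
    have hu := exp_mem_unitaryGroup (b := b) (Y := t • X) (by
      rw [Matrix.conjTranspose_smul, hXc, star_trivial, smul_neg])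
    simpa using hmax ⟨⟨_, hu⟩, (hsmul t).exp⟩
  have hzero := hloc.hasDerivAt_eq_zero (hasDerivAt_re_trace_exp X N)
  have hc : star (N * N).trace = (N.conjTranspose * N.conjTranspose).trace := by
    rw [← Matrix.trace_conjTranspose, Matrix.conjTranspose_mul]
  have hc2 : star (N.conjTranspose * N).trace = (N.conjTranspose * N).trace := by
    rw [← Matrix.trace_conjTranspose, Matrix.conjTranspose_mul, Matrix.conjTranspose_conjTranspose]
  have hre : (N.conjTranspose * N).trace.re = (N * N).trace.re := by
    rw [hX, Matrix.sub_mul, Matrix.trace_sub, Complex.sub_re] at hzero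
    linarith
  have htr : (X.conjTranspose * X).trace = 0 := by
    have h1 : (X.conjTranspose * X).trace =
        2 * (N.conjTranspose * N).trace - ((N * N).trace + star (N * N).trace) := by
      rw [hc, hXc, hX]
      simp only [Matrix.neg_mul, Matrix.sub_mul, Matrix.mul_sub, Matrix.trace_neg,
        Matrix.trace_sub]
      rw [Matrix.trace_mul_comm N N.conjTranspose]
      ring
    rw [h1, ← starRingEnd_apply, Complex.add_conj, ← hre,
      ← Complex.conj_eq_iff_re.1 hc2]
    simp
  have hX0 := Matrix.trace_conjTranspose_mul_self_eq_zero_iff.1 htr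
  exact sub_eq_zero.1 hX0

/-- The rectangular diagonal matrix with real diagonal entries `y`. -/
def diagGl (b : Dyson) (n m : ℕ) (y : Fin (n - m) → ℝ) : Gl b n m :=
  ofMat (realMat b (baseFrame n m * Matrix.diagonal y))

theorem toMat_diagGl (y : Fin (n - m) → ℝ) :
    toMat (diagGl b n m y) = realMat b (baseFrame n m * Matrix.diagonal y) :=
  toMat_ofMat (isFieldMat_realMat _)

theorem baseFrame_mul_diagonal_apply (y : Fin (n - m) → ℝ) (i j) :
    (baseFrame n m * Matrix.diagonal y) i j =
      if i = Fin.castLE (Nat.sub_le n m) j then y j else 0 := by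
  rw [Matrix.mul_diagonal]
  simp [baseFrame]

theorem toMat_diagGl_apply (y : Fin (n - m) → ℝ) (i s j t) :
    toMat (diagGl b n m y) (i, s) (j, t) =
      if s = t then (if i = Fin.castLE (Nat.sub_le n m) j then (y j : ℂ) else 0) else 0 := by
  rw [toMat_diagGl, realMat_apply, baseFrame_mul_diagonal_apply]
  split_ifs <;> simp

/-- Entrywise, the two conditions read M_lj c_j = c_l (M_jl)* and c_l M_lj = c_j (M_jl)*, so (c_l² -
c_j²) M_lj = 0. The first also kills the rows below the square part. The remaining diagonal numbers
are self-adjoint, hence real. -/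
theorem eq_diagGl_of_isHermitian {A : Gl b n m} {c : Fin (n - m) → ℝ} (hc : ∀ i, 0 < c i)
    (hinj : Function.Injective c)
    (h1 : (toMat A * (toMat (diagGl b n m c)).conjTranspose).conjTranspose =
      toMat A * (toMat (diagGl b n m c)).conjTranspose)
    (h2 : ((toMat (diagGl b n m c)).conjTranspose * toMat A).conjTranspose =
      (toMat (diagGl b n m c)).conjTranspose * toMat A) : ∃ y, A = diagGl b n m y := by
  set ι : Fin (n - m) → Fin n := Fin.castLE (Nat.sub_le n m) with hι
  have hιi : Function.Injective ι := Fin.castLE_injective _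
  set M := toMat A with hM
  have hD := toMat_diagGl_apply (b := b) c
  rw [← hι] at hD
  generalize toMat (diagGl b n m c) = D at h1 h2 hD
  have e1 : ∀ i s j t, (M * D.conjTranspose) (i, s) (ι j, t) =
      M (i, s) (j, t) * c j := by
    intro i s j t
    simp [Matrix.mul_apply, Fintype.sum_prod_type, hD, hιi.eq_iff, apply_ite]
  have e1' : ∀ i s k t, (∀ j, k ≠ ι j) →
      (M * D.conjTranspose) (i, s) (k, t) = 0 := by
    intro i s k t hk
    simp [Matrix.mul_apply, hD, hk]
  have e2 : ∀ i s j t, (D.conjTranspose * M) (i, s) (j, t) =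
      c i * M (ι i, s) (j, t) := by
    intro i s j t
    simp [Matrix.mul_apply, Fintype.sum_prod_type, hD, apply_ite]
  have g1 : ∀ l s j t, M (ι l, s) (j, t) * c j = star (M (ι j, t) (l, s)) * c l := by
    intro l s j t
    have := congrFun (congrFun h1 (ι l, s)) (ι j, t)
    rw [Matrix.conjTranspose_apply, e1, e1] at this
    rw [← this]
    simp
  have g1' : ∀ i s j t, (∀ l, i ≠ ι l) → M (i, s) (j, t) = 0 := by
    intro i s j t hi
    have := congrFun (congrFun h1 (i, s)) (ι j, t)
    rw [Matrix.conjTranspose_apply, e1, e1' _ _ _ _ hi, star_zero] at this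
    exact (mul_eq_zero.1 this.symm).resolve_right (Complex.ofReal_ne_zero.2 (hc j).ne')
  have g2 : ∀ l s j t, c l * M (ι l, s) (j, t) = c j * star (M (ι j, t) (l, s)) := by
    intro l s j t
    have := congrFun (congrFun h2 (l, s)) (j, t)
    rw [Matrix.conjTranspose_apply, e2, e2] at this
    rw [← this]
    simp
  have off : ∀ l s j t, l ≠ j → M (ι l, s) (j, t) = 0 := by
    intro l s j t hlj
    have hne : ((c l : ℂ) ^ 2 - (c j : ℂ) ^ 2) ≠ 0 := by
      rw [sub_ne_zero]
      norm_cast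
      intro h
      exact hlj (hinj ((sq_eq_sq₀ (hc l).le (hc j).le).1 h))
    have : ((c l : ℂ) ^ 2 - (c j : ℂ) ^ 2) * M (ι l, s) (j, t) = 0 := by
      linear_combination (c l : ℂ) * g2 l s j t - (c j : ℂ) * g1 l s j t
    exact (mul_eq_zero.1 this).resolve_left hne
  have diag : ∀ j s t, star (M (ι j, t) (j, s)) = M (ι j, s) (j, t) := by
    intro j s t
    exact (mul_right_cancel₀ (Complex.ofReal_ne_zero.2 (hc j).ne') (g1 j s j t)).symm
  have hreal : ∃ y : Fin (n - m) → ℝ, ∀ j s t,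
      M (ι j, s) (j, t) = if s = t then (y j : ℂ) else 0 := by
    have hF := isFieldMat_toMat A
    rw [← hM] at hF
    clear_value M
    cases b
    · refine ⟨fun j => (M (ι j, (0 : Fin 1)) (j, (0 : Fin 1))).re, fun j s t => ?_⟩
      fin_cases s; fin_cases t
      rw [if_pos rfl]
      exact (Complex.conj_eq_iff_re.1 (diag j _ _)).symm
    · refine ⟨fun j => (M (ι j, (0 : Fin 1)) (j, (0 : Fin 1))).re, fun j s t => ?_⟩
      fin_cases s; fin_cases t
      rw [if_pos rfl]
      exact (Complex.conj_eq_iff_re.1 (diag j _ _)).symm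
    · refine ⟨fun j => (M (ι j, (0 : Fin 2)) (j, (0 : Fin 2))).re, fun j s t => ?_⟩
      obtain ⟨h3, h4⟩ := isFieldMat_quaternion_iff.1 hF (ι j) j
      have h00 := Complex.conj_eq_iff_re.1 (diag j (0 : Fin 2) (0 : Fin 2))
      have h10 := diag j (0 : Fin 2) (1 : Fin 2)
      have h01 : M (ι j, (0 : Fin 2)) (j, (1 : Fin 2)) = 0 := by
        rw [h3, star_neg, star_star] at h10
        linear_combination (-1 / 2 : ℂ) * h10
      fin_cases s <;> fin_cases t
      · exact h00.symm
      · exact h01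
      · exact h3.trans (by rw [h01]; simp)
      · refine h4.trans ?_
        rw [← h00]
        simp
  obtain ⟨y, hy⟩ := hreal
  refine ⟨y, toMat_injective ?_⟩
  rw [← hM]
  ext1 ⟨i, s⟩ ⟨j, t⟩
  rw [toMat_diagGl_apply, ← hι]
  by_cases hi : ∃ l, i = ι l
  · obtain ⟨l, rfl⟩ := hi
    by_cases hlj : l = j
    · subst hlj
      rw [hy, if_pos rfl]
    · rw [off _ _ _ _ hlj]
      simp [hlj, hιi.eq_iff]
  · push Not at hi
    rw [g1' _ _ _ _ hi]
    simp [hi]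

/-- Maximize Re tr(D†UBV) over the two compact groups, for a fixed diagonal D with distinct positive
entries. Criticality in U and in V makes both products of UBV with D† Hermitian, which forces UBV to
be diagonal and real. -/
theorem exists_act_eq_diagGl (B : Gl b n m) : ∃ U V y, act U V B = diagGl b n m y := by
  let c : Fin (n - m) → ℝ := fun j => (j : ℝ) + 1
  have hc : ∀ i, 0 < c i := fun i => by positivity
  have hinj : Function.Injective c := fun i j h => by
    simp only [c, add_left_inj, Nat.cast_inj] at h
    exact Fin.ext h
  set D := toMat (diagGl b n m c) with hD
  have hDf : IsFieldMat b D := isFieldMat_toMat _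
  let φ : unitaryGrp b n × unitaryGrp b (n - m) → ℝ := fun x =>
    (D.conjTranspose * (x.1.1.1 * toMat B * x.2.1.1)).trace.re
  have hφ : Continuous φ := by
    refine Complex.continuous_re.comp (Continuous.matrix_trace ?_)
    refine continuous_const.matrix_mul (((Continuous.matrix_mul ?_ continuous_const)).matrix_mul ?_)
    · exact continuous_subtype_val.comp (continuous_subtype_val.comp continuous_fst)
    · exact continuous_subtype_val.comp (continuous_subtype_val.comp continuous_snd)
  obtain ⟨⟨U, V⟩, -, hmax⟩ := isCompact_univ.exists_isMaxOn Set.univ_nonempty hφ.continuousOn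
  have hmax' : ∀ U' V', φ (U', V') ≤ φ (U, V) := fun U' V' => hmax (Set.mem_univ (U', V'))
  have hM := toMat_act U V B
  have hMf : IsFieldMat b (toMat (act U V B)) := isFieldMat_toMat _
  refine ⟨U, V, eq_diagGl_of_isHermitian hc hinj ?_ ?_⟩
  · refine isHermitian_of_trace_le (hMf.mul hDf.conjTranspose) fun W => ?_
    have h1 : φ (W * U, V) = (W.1.1 * (toMat (act U V B) * D.conjTranspose)).trace.re := by
      change (D.conjTranspose * (W.1.1 * U.1.1 * toMat B * V.1.1)).trace.re = _
      rw [hM, Matrix.trace_mul_comm]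
      simp only [Matrix.mul_assoc]
    have h2 : φ (U, V) = (toMat (act U V B) * D.conjTranspose).trace.re := by
      rw [hM, Matrix.trace_mul_comm]
    rw [← h1, ← h2]
    exact hmax' _ _
  · refine isHermitian_of_trace_le (hDf.conjTranspose.mul hMf) fun W => ?_
    have h1 : φ (U, V * W) = (W.1.1 * (D.conjTranspose * toMat (act U V B))).trace.re := by
      change (D.conjTranspose * (U.1.1 * toMat B * (V.1.1 * W.1.1))).trace.re = _
      rw [hM, Matrix.trace_mul_comm W.1.1]
      simp only [Matrix.mul_assoc]
    have h2 : φ (U, V) = (D.conjTranspose * toMat (act U V B)).trace.re := by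
      rw [hM]
    rw [← h1, ← h2]
    exact hmax' _ _

end SingularValues

theorem aeval_ofReal {σ : Type*} (v : σ → ℝ) (p : MvPolynomial σ ℝ) :
    MvPolynomial.aeval (fun j => (v j : ℂ)) p = ((MvPolynomial.aeval v p : ℝ) : ℂ) :=
  MvPolynomial.aeval_algebraMap_apply ℂ v p

/-! ### The invariants -/

section Invariants

variable {b : Dyson} {n m : ℕ} {R S : Type*} [CommRing R] [Algebra ℂ R] [CommRing S] [Algebra ℂ S]

/-- Transfers identities from indeterminate coordinates to real points and to the substitution of
i∇. -/
theorem invariant_map (φ : R →ₐ[ℂ] S) (x : Idx b n m → R) (j : Fin (n - m)) :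
    invariant b n m (fun a => φ (x a)) j = φ (invariant b n m x j) := by
  have h : matAdj b n m (fun a => φ (x a)) * mat b n m (fun a => φ (x a)) =
      (matAdj b n m x * mat b n m x).map φ := by
    ext p q
    simp [Matrix.mul_apply, matAdj, mat, map_sum]
  rw [invariant, h, genPoly_map, Polynomial.coeff_map]
  rfl

theorem invariant_smul (t : R) (x : Idx b n m → R) (j : Fin (n - m)) :
    invariant b n m (fun a => t * x a) j = (t ^ 2) ^ ((j : ℕ) + 1) * invariant b n m x j := by
  have h : matAdj b n m (fun a => t * x a) * mat b n m (fun a => t * x a) =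
      t ^ 2 • (matAdj b n m x * mat b n m x) := by
    ext p q
    simp only [Matrix.mul_apply, matAdj, mat, Matrix.of_apply, Matrix.smul_apply, smul_eq_mul,
      mul_left_comm _ t, ← Finset.mul_sum]
    rw [sq, mul_assoc t t]
    congr 1
    rw [Finset.mul_sum]
    simp only [mul_assoc]
  rw [invariant, h, genPoly_smul, Polynomial.comp_C_mul_X_coeff, mul_comm]
  rfl

theorem matAdj_ofReal (B : Gl b n m) :
    matAdj b n m (fun a => (B a : ℂ)) = (toMat B).conjTranspose := by
  ext q p
  simp [matAdj, toMat, mat]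

theorem invariant_ofReal (B : Gl b n m) (j : Fin (n - m)) :
    invariant b n m (fun a => (B a : ℂ)) j =
      (genPoly b (n - m) ((toMat B).conjTranspose * toMat B)).coeff (j + 1) := by
  rw [invariant, matAdj_ofReal]
  rfl

theorem invariant_act (U : unitaryGrp b n) (V : unitaryGrp b (n - m)) (B : Gl b n m) :
    invariant b n m (fun a => (act U V B a : ℂ)) = invariant b n m (fun a => (B a : ℂ)) := by
  funext j
  rw [invariant_ofReal, invariant_ofReal, toMat_act]
  have h : (U.1.1 * toMat B * V.1.1).conjTranspose * (U.1.1 * toMat B * V.1.1) =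
      V.1.1.conjTranspose * ((toMat B).conjTranspose * toMat B) * V.1.1 := by
    calc _ = V.1.1.conjTranspose * ((toMat B).conjTranspose * (U.1.1.conjTranspose * U.1.1) *
          toMat B) * V.1.1 := by
          simp only [Matrix.conjTranspose_mul, Matrix.mul_assoc]
      _ = _ := by rw [conjTranspose_mul_self, Matrix.mul_one]
  rw [h, genPoly_conj]

omit [Algebra ℂ R] in
theorem coeff_prod_one_add_C_mul_X {k : ℕ} (d : Fin k → R) (l : ℕ) :
    (∏ i, (1 + Polynomial.C (d i) * Polynomial.X)).coeff l =
      ∑ t ∈ Finset.powersetCard l Finset.univ, ∏ i ∈ t, d i := by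
  rw [Finset.prod_one_add, Polynomial.finsetSum_coeff, Finset.powersetCard_eq_filter,
    Finset.sum_filter]
  refine Finset.sum_congr rfl fun t _ => ?_
  rw [Finset.prod_mul_distrib, Finset.prod_const, ← map_prod, Polynomial.coeff_C_mul_X_pow]
  simp only [eq_comm]

theorem invariant_diagGl (y : Fin (n - m) → ℝ) (j : Fin (n - m)) :
    invariant b n m (fun a => (diagGl b n m y a : ℂ)) j =
      ((MvPolynomial.aeval (fun i => y i ^ 2)
        (MvPolynomial.esymm (Fin (n - m)) ℝ (j + 1)) : ℝ) : ℂ) := by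
  have h : (toMat (diagGl b n m y)).conjTranspose * toMat (diagGl b n m y) =
      Matrix.diagonal fun p => ((y p.1 ^ 2 : ℝ) : ℂ) := by
    rw [toMat_diagGl, conjTranspose_realMat, ← realMat_mul, Matrix.transpose_mul, Matrix.mul_assoc,
      ← Matrix.mul_assoc _ (baseFrame n m), baseFrame_transpose_mul_self, Matrix.one_mul,
      Matrix.diagonal_transpose, Matrix.diagonal_mul_diagonal]
    ext ⟨i, s⟩ ⟨l, t⟩
    rw [realMat_apply, Matrix.diagonal_apply, Matrix.diagonal_apply]
    by_cases hs : s = t <;> by_cases hi : i = l <;> simp [hs, hi, sq]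
  rw [invariant_ofReal, h, genPoly_diagonal b (n - m) fun i => ((y i ^ 2 : ℝ) : ℂ),
    coeff_prod_one_add_C_mul_X, MvPolynomial.aeval_esymm_eq_multiset_esymm, Finset.esymm_map_val]
  push_cast
  rfl

theorem invariant_diagGl_eq (y : Fin (n - m) → ℝ) :
    invariant b n m (fun a => (diagGl b n m y a : ℂ)) = fun j : Fin (n - m) =>
      ((MvPolynomial.aeval (fun i => y i ^ 2)
        (MvPolynomial.esymm (Fin (n - m)) ℝ (j + 1)) : ℝ) : ℂ) :=
  funext (invariant_diagGl y)

end Invariants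

/-! ### Homogeneous parts of power series in the invariants -/

section HomPart

variable {k : ℕ}

/-- The weight of `x_{j+1}` is `j + 1`. -/
def invWeight (k : ℕ) : Fin k → ℕ := fun j => (j : ℕ) + 1

theorem weight_invWeight (α : Fin k →₀ ℕ) :
    Finsupp.weight (invWeight k) α = ∑ j : Fin k, ((j : ℕ) + 1) * α j := by
  rw [Finsupp.weight_apply, Finsupp.sum_fintype _ _ (by simp)]
  simp [invWeight, mul_comm]

/-- The box in `lowWeight` only ensures finiteness: the weight bound implies α_j ≤ N. -/
theorem mem_lowWeight {N : ℕ} {α : Fin k →₀ ℕ} :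
    α ∈ lowWeight k N ↔ 2 * Finsupp.weight (invWeight k) α ≤ N := by
  rw [lowWeight, Finset.mem_filter, weight_invWeight, Finset.mul_sum]
  simp only [← mul_assoc]
  refine ⟨fun h => h.2, fun h => ⟨?_, h⟩⟩
  rw [Finset.mem_Iic]
  intro j
  refine le_trans ?_ h
  refine le_trans ?_ (Finset.single_le_sum (f := fun j : Fin k => 2 * ((j : ℕ) + 1) * α j)
    (fun _ _ => Nat.zero_le _) (Finset.mem_univ j))
  exact Nat.le_mul_of_pos_left _ (by positivity)

/-- The terms of weight `e` of a power series. -/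
def homPart (e : ℕ) (Φ : MvPowerSeries (Fin k) ℝ) : MvPolynomial (Fin k) ℝ :=
  MvPolynomial.weightedHomogeneousComponent (invWeight k) e (truncate Φ (2 * e))

theorem coeff_homPart (e : ℕ) (Φ : MvPowerSeries (Fin k) ℝ) (α : Fin k →₀ ℕ) :
    (homPart e Φ).coeff α =
      if Finsupp.weight (invWeight k) α = e then MvPowerSeries.coeff α Φ else 0 := by
  rw [homPart, MvPolynomial.coeff_weightedHomogeneousComponent, truncate,
    MvPowerSeries.coeff_truncFinset]
  by_cases h : Finsupp.weight (invWeight k) α = e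
  · rw [if_pos h, if_pos h, if_pos (mem_lowWeight.2 (by rw [h]))]
  · rw [if_neg h, if_neg h]

/-- Degrees are twice the weights, so degree at most N means weight at most ⌊N/2⌋. -/
theorem truncate_eq_sum (Φ : MvPowerSeries (Fin k) ℝ) (N : ℕ) :
    truncate Φ N = ∑ e ∈ Finset.range (N / 2 + 1), homPart e Φ := by
  ext α
  rw [truncate, MvPowerSeries.coeff_truncFinset, MvPolynomial.coeff_sum]
  simp only [coeff_homPart]
  rw [Finset.sum_ite_eq]
  refine if_congr ?_ rfl rfl
  rw [mem_lowWeight, Finset.mem_range]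
  omega

theorem aeval_homPart_smul {e : ℕ} {Φ : MvPowerSeries (Fin k) ℝ} (s : ℂ) (v : Fin k → ℂ) :
    MvPolynomial.aeval (fun j : Fin k => s ^ ((j : ℕ) + 1) * v j) (homPart e Φ) =
      s ^ e * MvPolynomial.aeval v (homPart e Φ) := by
  rw [MvPolynomial.aeval_def, MvPolynomial.aeval_def, MvPolynomial.eval₂_eq',
    MvPolynomial.eval₂_eq', Finset.mul_sum]
  refine Finset.sum_congr rfl fun α hα => ?_
  have hw : Finsupp.weight (invWeight k) α = e := by
    by_contra h
    rw [MvPolynomial.mem_support_iff, coeff_homPart, if_neg h] at hα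
    exact hα rfl
  simp only [mul_pow, Finset.prod_mul_distrib, ← pow_mul]
  rw [Finset.prod_pow_eq_pow_sum, ← weight_invWeight, hw]
  ring

variable {b : Dyson} {n m : ℕ}

theorem aeval_invariant_smul_homPart (e : ℕ) (Φ : MvPowerSeries (Fin (n - m)) ℝ) {s : ℝ}
    (hs : 0 ≤ s) (B : Gl b n m) :
    MvPolynomial.aeval (invariant b n m fun a => ((√s • B) a : ℂ)) (homPart e Φ) =
      (s : ℂ) ^ e * MvPolynomial.aeval (invariant b n m fun a => (B a : ℂ)) (homPart e Φ) := by
  rw [← aeval_homPart_smul]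
  congr 2
  funext j
  have h : (fun a => ((√s • B) a : ℂ)) = fun a => ((√s : ℝ) : ℂ) * (B a : ℂ) := by
    funext a
    simp
  rw [h, invariant_smul, ← Complex.ofReal_pow, Real.sq_sqrt hs]

/-- Along the ray √s·B the sum becomes a power series in s with limit 0 for every s ≥ 0, so all its
coefficients vanish. -/
theorem aeval_homPart_eq {Φ : MvPowerSeries (Fin (n - m)) ℝ} {μ : ℕ → Gl b n m → ℂ}
    (hμ : ∀ e s B, 0 ≤ s → μ e (√s • B) = (s : ℂ) ^ e * μ e B)
    (h : ∀ B, Tendsto (fun N => ∑ e ∈ Finset.range N,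
      (MvPolynomial.aeval (invariant b n m fun a => (B a : ℂ)) (homPart e Φ) - μ e B))
        atTop (𝓝 0)) (e : ℕ) (B : Gl b n m) :
    MvPolynomial.aeval (invariant b n m fun a => (B a : ℂ)) (homPart e Φ) = μ e B := by
  refine sub_eq_zero.1 (eq_zero_of_tendsto_partial_sums (c := fun e =>
    MvPolynomial.aeval (invariant b n m fun a => (B a : ℂ)) (homPart e Φ) - μ e B)
    (fun s hs => ?_) e)
  refine (h (√s • B)).congr fun N => Finset.sum_congr rfl fun e _ => ?_
  rw [aeval_invariant_smul_homPart e Φ hs, hμ e s B hs, mul_sub]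

theorem homPart_ext {Φ Ψ : MvPowerSeries (Fin (n - m)) ℝ}
    (h : ∀ e (B : Gl b n m),
      MvPolynomial.aeval (invariant b n m fun a => (B a : ℂ)) (homPart e Φ) =
        MvPolynomial.aeval (invariant b n m fun a => (B a : ℂ)) (homPart e Ψ)) : Φ = Ψ := by
  have hpart : ∀ e, homPart e Φ = homPart e Ψ := by
    intro e
    refine sub_eq_zero.1 (eq_zero_of_aeval_esymm_sq fun y => ?_)
    have hy := h e (diagGl b n m y)
    rw [invariant_diagGl_eq] at hy
    apply Complex.ofReal_injective
    rw [← aeval_ofReal, map_sub, hy, sub_self, Complex.ofReal_zero]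
  ext α
  have := congrArg (MvPolynomial.coeff α) (hpart (Finsupp.weight (invWeight _) α))
  simpa [coeff_homPart] using this

end HomPart

/-! ### Moments of the invariant measure -/

section Moments

variable {b : Dyson} {n m : ℕ}

theorem ae_mem_range_frame : ∀ᵐ A ∂(stiefelMeasure b n m), A ∈ Set.range (frame b n m) := by
  have hK : IsCompact (Set.range (frame b n m)) := isCompact_range continuous_frame
  exact (ae_map_iff continuous_frame.aemeasurable hK.isClosed.measurableSet).2
    (Eventually.of_forall fun U => ⟨U, rfl⟩)

theorem ae_mem_stiefel : ∀ᵐ A ∂(stiefelMeasure b n m), A ∈ stiefel b n m :=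
  ae_mem_range_frame.mono fun _ ⟨U, hU⟩ => hU ▸ frame_mem_stiefel U

/-- The measure is carried by the compact image of `frame`; whether this image fills `stiefel` is
irrelevant. -/
theorem integrable_of_continuousOn {E : Type*} [NormedAddCommGroup E] {f : Gl b n m → E}
    (hf : ContinuousOn f (stiefel b n m)) : Integrable f (stiefelMeasure b n m) := by
  have hK : IsCompact (Set.range (frame b n m)) := isCompact_range continuous_frame
  have hsub : Set.range (frame b n m) ⊆ stiefel b n m := by
    rintro _ ⟨U, rfl⟩
    exact frame_mem_stiefel U
  have h := (hf.mono hsub).integrableOn_compact (μ := stiefelMeasure b n m) hK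
  rwa [IntegrableOn, Measure.restrict_eq_self_of_ae_mem ae_mem_range_frame] at h

/-- The moments of the invariant measure. -/
def moment (b : Dyson) (n m d : ℕ) (B : Gl b n m) : ℝ :=
  ∫ A, (B ⬝ᵥ A) ^ d ∂(stiefelMeasure b n m)

theorem moment_act (d : ℕ) (U : unitaryGrp b n) (V : unitaryGrp b (n - m)) (B : Gl b n m) :
    moment b n m d (act U V B) = moment b n m d B := by
  have := integral_act (h := fun x => ((x ^ d : ℝ) : ℂ)) (by fun_prop) U V B
  rw [integral_complex_ofReal, integral_complex_ofReal] at this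
  exact Complex.ofReal_injective this

theorem moment_smul (d : ℕ) (t : ℝ) (B : Gl b n m) :
    moment b n m d (t • B) = t ^ d * moment b n m d B := by
  simp only [moment, smul_dotProduct, smul_eq_mul, mul_pow]
  exact integral_const_mul _ _

/-- The moments as polynomials. -/
def momentPoly (b : Dyson) (n m d : ℕ) : MvPolynomial (Idx b n m) ℝ :=
  ∑ g : Fin d → Idx b n m, MvPolynomial.C (∫ A, ∏ i, A (g i) ∂(stiefelMeasure b n m)) *
    ∏ i, MvPolynomial.X (g i)

theorem integrable_prod_apply {d : ℕ} (g : Fin d → Idx b n m) :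
    Integrable (fun A : Gl b n m => ∏ i, A (g i)) (stiefelMeasure b n m) :=
  integrable_of_continuousOn (by fun_prop)

theorem eval_momentPoly (d : ℕ) (B : Gl b n m) :
    MvPolynomial.eval B (momentPoly b n m d) = moment b n m d B := by
  simp only [moment, momentPoly, dotProduct, Fintype.sum_pow, map_sum, map_mul, map_prod,
    MvPolynomial.eval_C, MvPolynomial.eval_X, Finset.prod_mul_distrib]
  rw [integral_finsetSum _ fun g _ => (integrable_prod_apply g).const_mul _]
  refine Finset.sum_congr rfl fun g _ => ?_
  rw [integral_const_mul, mul_comm]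

/-- A real orthogonal matrix as an element of the group. -/
def orthogonalGrp (b : Dyson) {p : ℕ} (R : Matrix (Fin p) (Fin p) ℝ)
    (hR : R.transpose * R = 1) : unitaryGrp b p :=
  ⟨⟨realMat b R, by
    rw [Matrix.mem_unitaryGroup_iff', Matrix.star_eq_conjTranspose, conjTranspose_realMat,
      ← realMat_mul, hR, realMat_one]⟩, isFieldMat_realMat R⟩

/-- `R` has size n - m and acts from the left only after extension to size n. -/
theorem moment_diagGl_eq (d : ℕ) {R S : Matrix (Fin (n - m)) (Fin (n - m)) ℝ}
    (hR : R.transpose * R = 1) (hS : S.transpose * S = 1) {y z : Fin (n - m) → ℝ}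
    (h : R * Matrix.diagonal y * S = Matrix.diagonal z) :
    moment b n m d (diagGl b n m z) = moment b n m d (diagGl b n m y) := by
  obtain ⟨W, hW⟩ := exists_extend (n := n) (m := m) (orthogonalGrp b R hR)
  rw [← moment_act d W (orthogonalGrp b S hS) (diagGl b n m y)]
  congr 1
  apply toMat_injective
  rw [toMat_act, toMat_diagGl, toMat_diagGl, realMat_mul, realMat_mul, ← Matrix.mul_assoc W.1.1,
    hW, ← h]
  change _ = realMat b (baseFrame n m) * realMat b R * _ * realMat b S
  rw [realMat_mul, realMat_mul]
  simp only [Matrix.mul_assoc]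

theorem moment_diagGl_perm (d : ℕ) (σ : Equiv.Perm (Fin (n - m))) (y : Fin (n - m) → ℝ) :
    moment b n m d (diagGl b n m (y ∘ σ)) = moment b n m d (diagGl b n m y) := by
  refine moment_diagGl_eq d (R := (1 : Matrix _ _ ℝ).submatrix σ id)
    (S := (1 : Matrix _ _ ℝ).submatrix id σ) ?_ ?_ ?_
  · rw [Matrix.transpose_submatrix, Matrix.submatrix_mul_equiv, Matrix.transpose_one,
      Matrix.one_mul, Matrix.submatrix_id_id]
  · ext i j
    simp [Matrix.mul_apply, Matrix.one_apply]
  · ext i j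
    by_cases h : i = j <;> simp [Matrix.mul_apply, Matrix.one_apply, Matrix.diagonal_apply, h]

/-- For β = 1 and m = 0 this uses a reflection, which lies in O(n) but not in SO(n). -/
theorem moment_diagGl_neg (d : ℕ) (i : Fin (n - m)) (y : Fin (n - m) → ℝ) :
    moment b n m d (diagGl b n m (Function.update y i (-y i))) =
      moment b n m d (diagGl b n m y) := by
  refine moment_diagGl_eq d (R := Matrix.diagonal fun j => if j = i then -1 else 1)
    (S := 1) ?_ (by simp) ?_
  · rw [Matrix.diagonal_transpose, Matrix.diagonal_mul_diagonal, ← Matrix.diagonal_one]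
    congr 1
    funext j
    split_ifs <;> simp
  · rw [Matrix.mul_one, Matrix.diagonal_mul_diagonal]
    congr 1
    funext j
    by_cases h : j = i
    · subst h; simp
    · simp [h]

theorem momentPoly_odd {d : ℕ} (hd : Odd d) : momentPoly b n m d = 0 := by
  refine MvPolynomial.funext fun B => ?_
  rw [eval_momentPoly, map_zero]
  have h1 : act (orthogonalGrp b (-1) (by simp)) 1 B = (-1 : ℝ) • B := by
    apply toMat_injective
    rw [toMat_act]
    ext1 ⟨i, s⟩ ⟨j, t⟩
    have h3 : realMat b (-1 : Matrix (Fin n) (Fin n) ℝ) = -1 := by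
      rw [← realMat_one]
      ext ⟨i, s⟩ ⟨j, t⟩
      rw [Matrix.neg_apply, realMat_apply, realMat_apply]
      by_cases hs : s = t <;> simp [hs]
    change (realMat b (-1 : Matrix (Fin n) (Fin n) ℝ) * toMat B *
      (1 : Matrix (Fin (n - m) × Fin b.gamma) (Fin (n - m) × Fin b.gamma) ℂ)) _ _ = _
    rw [h3]
    simp [toMat, mat]
  have h2 := moment_act d (orthogonalGrp b (-1) (by simp)) 1 B
  rw [h1, moment_smul, hd.neg_one_pow] at h2
  linarith

/-- Linearity in y, in the form that turns the restriction of `momentPoly` to diagonal matrices into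
a polynomial by substitution. -/
theorem diagGl_apply (y : Fin (n - m) → ℝ) (a : Idx b n m) :
    diagGl b n m y a = diagGl b n m 1 a * y a.2.1 := by
  obtain ⟨i, j, c⟩ := a
  have h : ∀ (y : Fin (n - m) → ℝ), diagGl b n m y (i, j, c) = coords b (Matrix.of fun s t =>
      if s = t then (if i = Fin.castLE (Nat.sub_le n m) j then (y j : ℂ) else 0) else 0) c := by
    intro y
    simp only [diagGl, ofMat, realMat_apply, baseFrame_mul_diagonal_apply]
    congr 2
    ext s t
    split_ifs <;> simp
  rw [h, h]
  by_cases hij : i = Fin.castLE (Nat.sub_le n m) j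
  · simp only [if_pos hij]
    cases b <;> fin_cases c <;> simp [coords]
  · simp only [if_neg hij]
    cases b <;> fin_cases c <;> simp [coords]

theorem exists_momentInvariant (b : Dyson) (n m e : ℕ) : ∃ Φ : MvPowerSeries (Fin (n - m)) ℝ,
    ∀ B : Gl b n m, MvPolynomial.aeval (invariant b n m fun a => (B a : ℂ)) (homPart e Φ) =
      (moment b n m (2 * e) B : ℂ) := by
  let P : MvPolynomial (Fin (n - m)) ℝ := MvPolynomial.aeval
    (fun a : Idx b n m => MvPolynomial.C (diagGl b n m 1 a) * MvPolynomial.X a.2.1)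
    (momentPoly b n m (2 * e))
  have hP : ∀ y, MvPolynomial.eval y P = moment b n m (2 * e) (diagGl b n m y) := by
    intro y
    rw [← eval_momentPoly, ← MvPolynomial.coe_aeval_eq_eval, RingHom.coe_coe,
      MvPolynomial.comp_aeval_apply, ← MvPolynomial.coe_aeval_eq_eval, RingHom.coe_coe]
    congr 2
    funext a
    rw [diagGl_apply y a]
    simp
  obtain ⟨r, hr⟩ := exists_aeval_esymm_sq (P := P)
    (fun i y => by rw [hP, hP, moment_diagGl_neg])
    (fun σ y => by rw [hP, hP, moment_diagGl_perm])
  have hr' : ∀ B : Gl b n m, MvPolynomial.aeval (invariant b n m fun a => (B a : ℂ)) r =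
      (moment b n m (2 * e) B : ℂ) := by
    intro B
    obtain ⟨U, V, y, hy⟩ := exists_act_eq_diagGl B
    rw [← invariant_act U V B, ← moment_act (2 * e) U V B, hy, ← hP, ← hr,
      invariant_diagGl_eq, aeval_ofReal]
  obtain ⟨N₀, hN₀⟩ : ∃ N₀, ∀ N, N₀ ≤ N → truncate (r : MvPowerSeries (Fin (n - m)) ℝ) N = r := by
    refine ⟨r.support.sup fun α => 2 * Finsupp.weight (invWeight _) α, fun N hN => ?_⟩
    ext α
    rw [truncate, MvPowerSeries.coeff_truncFinset, MvPolynomial.coeff_coe]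
    by_cases hα : α ∈ r.support
    · rw [if_pos (mem_lowWeight.2 (le_trans (Finset.le_sup
        (f := fun α => 2 * Finsupp.weight (invWeight _) α) hα) hN))]
    · rw [MvPolynomial.notMem_support_iff.1 hα, ite_self]
  refine ⟨r, fun B => ?_⟩
  -- A priori `r` may have terms of several weights; comparison along rays shows that its part of
  -- weight e alone gives the moment.
  have key := aeval_homPart_eq (b := b) (Φ := (r : MvPowerSeries (Fin (n - m)) ℝ))
    (μ := fun e' B => if e' = e then (moment b n m (2 * e) B : ℂ) else 0) ?_ ?_ e B
  · simpa using key
  · intro e' s B hs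
    by_cases h : e' = e
    · subst h
      simp only [if_true]
      rw [moment_smul, pow_mul, Real.sq_sqrt hs]
      push_cast
      rfl
    · simp [h]
  · intro B
    refine tendsto_const_nhds.congr' ?_
    filter_upwards [eventually_ge_atTop (N₀ + e + 1)] with N hN
    obtain ⟨M, rfl⟩ : ∃ M, N = M + 1 := ⟨N - 1, by omega⟩
    rw [Finset.sum_sub_distrib, ← map_sum, Finset.sum_ite_eq', if_pos (Finset.mem_range.2 (by omega)),
      ← hr' B]
    have h1 := truncate_eq_sum (r : MvPowerSeries (Fin (n - m)) ℝ) (2 * M)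
    rw [Nat.mul_div_cancel_left _ two_pos, hN₀ (2 * M) (by omega)] at h1
    rw [← h1, sub_self]

end Moments

/-! ### The Leutwyler–Smilga integral -/

section Series

variable {b : Dyson} {n m : ℕ}

theorem tendsto_even_partial_sums {c : ℕ → ℂ} {l : ℂ} (hodd : ∀ d, Odd d → c d = 0)
    (h : Tendsto (fun N => ∑ d ∈ Finset.range N, c d) atTop (𝓝 l)) :
    Tendsto (fun N => ∑ e ∈ Finset.range N, c (2 * e)) atTop (𝓝 l) := by
  have hsum : ∀ N, ∑ e ∈ Finset.range N, c (2 * e) = ∑ d ∈ Finset.range (2 * N), c d := by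
    intro N
    induction N with
    | zero => simp
    | succ N ih =>
      rw [Finset.sum_range_succ, ih, Nat.mul_succ, Finset.sum_range_succ, Finset.sum_range_succ,
        hodd (2 * N + 1) ⟨N, rfl⟩, add_zero]
  simp only [hsum]
  exact h.comp (tendsto_id.const_mul_atTop' two_pos)

theorem psiHat_eq (B : Gl b n m) :
    psiHat b n m B = ∫ A, Complex.exp (Complex.I * ((B ⬝ᵥ A : ℝ) : ℂ)) ∂(stiefelMeasure b n m) := by
  have hγ : (2 * (b.gamma : ℂ)) ≠ 0 := by cases b <;> simp
  rw [psiHat]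
  congr 1
  funext A
  rw [trace_pairing, mul_left_comm, mul_div_cancel_left₀ _ hγ]

theorem moment_odd {d : ℕ} (hd : Odd d) (B : Gl b n m) : moment b n m d B = 0 := by
  rw [← eval_momentPoly, momentPoly_odd hd, map_zero]

/-- The coefficients of the expansion of `psiHat` in the moments. -/
def seriesCoeff (e : ℕ) : ℝ := (-1) ^ e / ((2 * e).factorial : ℝ)

/-- The exponential series is integrated termwise under the majorant exp |B·A|, which is bounded on
the compact carrier of the measure. -/
theorem tendsto_psiHat (B : Gl b n m) :
    Tendsto (fun N => ∑ e ∈ Finset.range N, ((seriesCoeff e * moment b n m (2 * e) B : ℝ) : ℂ))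
      atTop (𝓝 (psiHat b n m B)) := by
  have hcont : Continuous fun A : Gl b n m => B ⬝ᵥ A := continuous_const.dotProduct continuous_id
  have hsum : HasSum (fun d : ℕ => ∫ A, (Complex.I * ((B ⬝ᵥ A : ℝ) : ℂ)) ^ d / (d.factorial : ℂ)
      ∂(stiefelMeasure b n m)) (psiHat b n m B) := by
    rw [psiHat_eq]
    refine hasSum_integral_of_dominated_convergence
      (fun d A => |B ⬝ᵥ A| ^ d / (d.factorial : ℝ)) (fun d => ?_) (fun d => ?_) ?_ ?_ ?_
    · exact Continuous.aestronglyMeasurable (by fun_prop)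
    · refine Eventually.of_forall fun A => ?_
      simp
    · exact Eventually.of_forall fun A => Real.summable_pow_div_factorial _
    · have : (fun A : Gl b n m => ∑' d : ℕ, |B ⬝ᵥ A| ^ d / (d.factorial : ℝ)) =
          fun A => Real.exp |B ⬝ᵥ A| := by
        funext A
        rw [Real.exp_eq_exp_ℝ, NormedSpace.exp_eq_tsum_div]
      rw [this]
      exact integrable_of_continuousOn (by fun_prop)
    · refine Eventually.of_forall fun A => ?_
      rw [Complex.exp_eq_exp_ℂ]
      exact NormedSpace.expSeries_div_hasSum_exp _
  have hterm : ∀ d : ℕ, ∫ A, (Complex.I * ((B ⬝ᵥ A : ℝ) : ℂ)) ^ d / (d.factorial : ℂ)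
      ∂(stiefelMeasure b n m) = Complex.I ^ d / (d.factorial : ℂ) * (moment b n m d B : ℂ) := by
    intro d
    rw [moment, ← integral_complex_ofReal, ← integral_const_mul]
    congr 1
    funext A
    push_cast
    ring
  simp only [hterm] at hsum
  refine (tendsto_even_partial_sums (fun d hd => ?_) hsum.tendsto_sum_nat).congr fun N => ?_
  · rw [moment_odd hd]; simp
  · refine Finset.sum_congr rfl fun e _ => ?_
    rw [seriesCoeff, pow_mul, Complex.I_sq]
    push_cast
    rfl

/-- Splits the limit condition into one algebraic identity per weight; existence, uniqueness and the
integral formula all rest on it. -/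
theorem representsPsiHat_iff {Φ : MvPowerSeries (Fin (n - m)) ℝ} :
    RepresentsPsiHat b n m Φ ↔ ∀ e (B : Gl b n m),
      MvPolynomial.aeval (invariant b n m fun a => (B a : ℂ)) (homPart e Φ) =
        ((seriesCoeff e * moment b n m (2 * e) B : ℝ) : ℂ) := by
  constructor
  · intro h
    refine aeval_homPart_eq (μ := fun e B => ((seriesCoeff e * moment b n m (2 * e) B : ℝ) : ℂ))
      (fun e s B hs => ?_) fun B => ?_
    · rw [moment_smul, pow_mul, Real.sq_sqrt hs]
      push_cast
      ring
    · have h1 : Tendsto (fun M => MvPolynomial.aeval (invariant b n m fun a => (B a : ℂ))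
          (truncate Φ (2 * M))) atTop (𝓝 (psiHat b n m B)) :=
        (h B).comp (tendsto_id.const_mul_atTop' two_pos)
      have h2 := h1.sub ((tendsto_add_atTop_iff_nat 1).2 (tendsto_psiHat B))
      rw [sub_self] at h2
      refine (tendsto_add_atTop_iff_nat 1).1 (h2.congr fun M => ?_)
      rw [truncate_eq_sum, Nat.mul_div_cancel_left _ two_pos, map_sum, Finset.sum_sub_distrib]
  · intro h B
    have hN : Tendsto (fun N : ℕ => N / 2 + 1) atTop atTop :=
      tendsto_atTop_atTop.2 fun K => ⟨2 * K, fun N hN => by omega⟩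
    refine ((tendsto_psiHat B).comp hN).congr fun N => ?_
    rw [truncate_eq_sum, map_sum]
    exact Finset.sum_congr rfl fun e _ => (h e B).symm

theorem exists_representsPsiHat (b : Dyson) (n m : ℕ) :
    ∃ Ψ : MvPowerSeries (Fin (n - m)) ℝ, RepresentsPsiHat b n m Ψ := by
  choose Φ hΦ using exists_momentInvariant b n m
  -- Each monomial has exactly one weight, so the parts of weight e of the series `Φ e` glue without
  -- overlap.
  let Ψ : MvPowerSeries (Fin (n - m)) ℝ := fun α =>
    seriesCoeff (Finsupp.weight (invWeight _) α) *
      MvPowerSeries.coeff α (Φ (Finsupp.weight (invWeight _) α))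
  have hpart : ∀ e, homPart e Ψ = MvPolynomial.C (seriesCoeff e) * homPart e (Φ e) := by
    intro e
    ext α
    rw [MvPolynomial.coeff_C_mul, coeff_homPart, coeff_homPart]
    split_ifs with h
    · rw [← h]; rfl
    · rw [mul_zero]
  refine ⟨Ψ, representsPsiHat_iff.2 fun e B => ?_⟩
  rw [hpart, map_mul, hΦ, MvPolynomial.aeval_C]
  push_cast
  rfl

end Series

/-! ### Integration over the Stiefel manifold as a differential operator -/

section Integration

variable {b : Dyson} {n m : ℕ}

theorem tendsto_integral_of_tendstoUniformlyOn {F : ℕ → Gl b n m → ℂ} {f : Gl b n m → ℂ}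
    (hF : ∀ N, ContinuousOn (F N) (stiefel b n m)) (hf : ContinuousOn f (stiefel b n m))
    (h : TendstoUniformlyOn F f atTop (stiefel b n m)) :
    Tendsto (fun N => ∫ A, F N A ∂(stiefelMeasure b n m)) atTop
      (𝓝 (∫ A, f A ∂(stiefelMeasure b n m))) := by
  refine tendsto_integral_filter_of_dominated_convergence (fun A => ‖f A‖ + 1)
    (Eventually.of_forall fun N => (integrable_of_continuousOn (hF N)).aestronglyMeasurable) ?_
    ((integrable_of_continuousOn hf).norm.add (integrable_const 1)) ?_
  · filter_upwards [Metric.tendstoUniformlyOn_iff.1 h 1 one_pos] with N hN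
    filter_upwards [ae_mem_stiefel] with A hA
    have h1 := hN A hA
    rw [dist_eq_norm] at h1
    have h2 := norm_sub_norm_le (F N A) (f A)
    rw [norm_sub_rev] at h2
    linarith
  · filter_upwards [ae_mem_stiefel] with A hA
    exact h.tendsto_at hA

/-- The moments as complex polynomials. -/
def momentSymbol (b : Dyson) (n m d : ℕ) : MvPolynomial (Idx b n m) ℂ :=
  MvPolynomial.map Complex.ofRealHom (momentPoly b n m d)

theorem momentSymbol_eq (d : ℕ) : momentSymbol b n m d = ∑ g : Fin d → Idx b n m,
    MvPolynomial.C ((∫ A, ∏ i, A (g i) ∂(stiefelMeasure b n m) : ℝ) : ℂ) *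
      ∏ i, MvPolynomial.X (g i) := by
  simp [momentSymbol, momentPoly, map_sum, map_prod]

theorem aeval_invariantSymbol_homPart {Ψ : MvPowerSeries (Fin (n - m)) ℝ}
    (hΨ : RepresentsPsiHat b n m Ψ) (e : ℕ) :
    MvPolynomial.aeval (invariantSymbol b n m) (homPart e Ψ) =
      ((2 * e).factorial : ℂ)⁻¹ • momentSymbol b n m (2 * e) := by
  have hX : MvPolynomial.aeval (invariant b n m (MvPolynomial.X : _ → MvPolynomial (Idx b n m) ℂ))
      (homPart e Ψ) = (seriesCoeff e : ℂ) • momentSymbol b n m (2 * e) := by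
    -- Real points suffice to identify complex polynomials, and at real points the identity is
    -- `representsPsiHat_iff`.
    refine MvPolynomial.funext_set (fun _ => Set.range ((↑) : ℝ → ℂ))
      (fun _ => Set.infinite_range_of_injective Complex.ofReal_injective) fun x hx => ?_
    choose B hB using fun a => hx a (Set.mem_univ a)
    obtain rfl : x = fun a => (B a : ℂ) := funext fun a => (hB a).symm
    rw [← MvPolynomial.coe_aeval_eq_eval, RingHom.coe_coe]
    have h1 := MvPolynomial.comp_aeval_apply
      (f := invariant b n m (MvPolynomial.X : _ → MvPolynomial (Idx b n m) ℂ))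
      ((MvPolynomial.aeval (R := ℂ) fun a => (B a : ℂ)).restrictScalars ℝ) (homPart e Ψ)
    refine h1.trans ?_
    have h2 : (fun j => ((MvPolynomial.aeval (R := ℂ) fun a => (B a : ℂ)).restrictScalars ℝ)
        (invariant b n m (MvPolynomial.X : _ → MvPolynomial (Idx b n m) ℂ) j)) =
        invariant b n m fun a => (B a : ℂ) := by
      funext j
      refine (invariant_map (MvPolynomial.aeval (R := ℂ) fun a => (B a : ℂ)) _ j).symm.trans ?_
      simp
    rw [h2, representsPsiHat_iff.1 hΨ, map_smul, smul_eq_mul, Complex.ofReal_mul]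
    congr 1
    rw [← eval_momentPoly]
    exact ((MvPolynomial.aeval_map_algebraMap ℂ _ _).trans (aeval_ofReal B _)).symm
  let ψ : MvPolynomial (Idx b n m) ℂ →ₐ[ℂ] MvPolynomial (Idx b n m) ℂ :=
    MvPolynomial.aeval fun a => MvPolynomial.C Complex.I * MvPolynomial.X a
  have h1 := MvPolynomial.comp_aeval_apply
      (f := invariant b n m (MvPolynomial.X : _ → MvPolynomial (Idx b n m) ℂ))
      (ψ.restrictScalars ℝ) (homPart e Ψ)
  have h2 : (fun j => (ψ.restrictScalars ℝ)
      (invariant b n m (MvPolynomial.X : _ → MvPolynomial (Idx b n m) ℂ) j)) =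
        invariantSymbol b n m := by
    funext j
    refine (invariant_map ψ _ j).symm.trans ?_
    simp [ψ, invariantSymbol]
  have h3 : ψ (momentSymbol b n m (2 * e)) = ((-1) ^ e : ℂ) • momentSymbol b n m (2 * e) := by
    rw [momentSymbol_eq, map_sum, Finset.smul_sum]
    refine Finset.sum_congr rfl fun g _ => ?_
    simp only [ψ, map_mul, map_prod, MvPolynomial.aeval_X, MvPolynomial.aeval_C,
      MvPolynomial.algebraMap_eq, Finset.prod_mul_distrib, Finset.prod_const, Finset.card_univ,
      Fintype.card_fin]
    rw [← map_pow, pow_mul, Complex.I_sq, MvPolynomial.smul_eq_C_mul]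
    ring
  rw [← h2, ← h1, hX]
  change ψ _ = _
  rw [map_smul, h3, smul_smul, seriesCoeff]
  congr 1
  push_cast
  rw [div_mul_eq_mul_div, ← mul_pow]
  simp

/-- The symbol is ∫ (A·∇)^d dA, and (A·∇)^d f at 0 is D^d f(0)(A,…,A). -/
theorem diffOpLin_momentSymbol {f : Gl b n m → ℂ} {s : Set (Gl b n m)} (hs : IsOpen s)
    (hf : ContDiffOn ℝ ∞ f s) (h0 : (0 : Gl b n m) ∈ s) (d : ℕ) :
    diffOpLin f 0 (momentSymbol b n m d) =
      ∫ A, iteratedFDeriv ℝ d f 0 (fun _ => A) ∂(stiefelMeasure b n m) := by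
  have hexp : ∀ A : Gl b n m, iteratedFDeriv ℝ d f 0 (fun _ => A) =
      ∑ g : Fin d → Idx b n m, (∏ i, A (g i)) •
        iteratedFDeriv ℝ d f 0 fun i => Pi.single (g i) (1 : ℝ) := by
    intro A
    conv_lhs => rw [pi_eq_sum_univ' A]
    rw [ContinuousMultilinearMap.map_sum]
    refine Finset.sum_congr rfl fun g _ => ?_
    rw [← ContinuousMultilinearMap.map_smul_univ]
  simp only [hexp]
  rw [integral_finsetSum _ fun g _ => (integrable_prod_apply g).smul_const _, momentSymbol_eq,
    map_sum]
  refine Finset.sum_congr rfl fun g _ => ?_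
  rw [integral_smul_const, ← MvPolynomial.smul_eq_C_mul, map_smul, diffOpLin_prod_X hs hf h0]
  simp

theorem continuous_iteratedFDeriv_diagonal (d : ℕ) (f : Gl b n m → ℂ) :
    Continuous fun A => iteratedFDeriv ℝ d f 0 fun _ => A :=
  (iteratedFDeriv ℝ d f 0).cont.comp (continuous_pi fun _ => continuous_id)

theorem tendsto_diffOp_of_mem_analyticSpace {Ψ : MvPowerSeries (Fin (n - m)) ℝ}
    (hΨ : RepresentsPsiHat b n m Ψ) {f : Gl b n m → ℂ} (hf : f ∈ analyticSpace b n m) :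
    Integrable f (stiefelMeasure b n m) ∧
      Tendsto (fun N => diffOp (MvPolynomial.aeval (invariantSymbol b n m) (truncate Ψ N)) f 0)
        atTop (𝓝 (∫ A, f A ∂(stiefelMeasure b n m))) := by
  obtain ⟨Ω, hΩ, hsm, hmem, hunif⟩ := hf
  have hsub : stiefel b n m ⊆ Ω := fun A hA => by
    simpa using hmem A hA 1 ⟨zero_le_one, le_rfl⟩
  -- The case λ = 0 of the condition on Ω, applied to any one frame.
  have h0 : (0 : Gl b n m) ∈ Ω := by
    simpa using hmem _ (frame_mem_stiefel (m := m) (1 : unitaryGrp b n)) 0 ⟨le_rfl, zero_le_one⟩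
  have hfc : ContinuousOn f (stiefel b n m) := hsm.continuousOn.mono hsub
  refine ⟨integrable_of_continuousOn hfc, ?_⟩
  have hlim := tendsto_integral_of_tendstoUniformlyOn (fun N => by
    refine Continuous.continuousOn ?_
    exact continuous_finsetSum _ fun d _ =>
      continuous_const.mul (continuous_iteratedFDeriv_diagonal d f)) hfc (hunif.mono hsub)
  have hterm : ∀ N, ∫ A, ∑ d ∈ Finset.range N, ((d.factorial : ℂ))⁻¹ *
      iteratedFDeriv ℝ d f 0 (fun _ => A) ∂(stiefelMeasure b n m) =
      ∑ d ∈ Finset.range N, (d.factorial : ℂ)⁻¹ * diffOpLin f 0 (momentSymbol b n m d) := by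
    intro N
    rw [integral_finsetSum _ fun d _ => (integrable_of_continuousOn
      (continuous_iteratedFDeriv_diagonal d f).continuousOn).const_mul _]
    refine Finset.sum_congr rfl fun d _ => ?_
    rw [integral_const_mul, diffOpLin_momentSymbol hΩ hsm h0]
  simp only [hterm] at hlim
  have heven := tendsto_even_partial_sums (fun d hd => by
    rw [momentSymbol, momentPoly_odd hd, map_zero, map_zero, mul_zero]) hlim
  have hN : Tendsto (fun N : ℕ => N / 2 + 1) atTop atTop :=
    tendsto_atTop_atTop.2 fun K => ⟨2 * K, fun N hN => by omega⟩
  refine (heven.comp hN).congr fun N => ?_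
  change _ = diffOpLin f 0 _
  rw [truncate_eq_sum, map_sum, map_sum]
  refine Finset.sum_congr rfl fun e _ => ?_
  rw [aeval_invariantSymbol_homPart hΨ, map_smul, smul_eq_mul]

end Integration

end Pizzetti
end

/-- There is exactly one formal power series `Ψ` with `Ψ(I_1(B), …, I_{n-m}(B)) = Ψ̂(B)` for all `B`,
and `∫ f = (Ψ(I_1, …, I_{n-m}) f)(0)` for all `f` in `𝒜^(β)(n,m)`, with a convergent right-hand
side. -/
theorem theorem4p1 (b : Pizzetti.Dyson) (n m : ℕ) (hmn : m < n) :
    ∃ Ψ : MvPowerSeries (Fin (n - m)) ℝ,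
      (∀ Φ : MvPowerSeries (Fin (n - m)) ℝ, Pizzetti.RepresentsPsiHat b n m Φ ↔ Φ = Ψ) ∧
      ∀ f ∈ Pizzetti.analyticSpace b n m,
        Integrable f (Pizzetti.stiefelMeasure b n m) ∧
        Tendsto
          (fun N => Pizzetti.diffOp
            (MvPolynomial.aeval (Pizzetti.invariantSymbol b n m) (Pizzetti.truncate Ψ N)) f 0)
          atTop (𝓝 (∫ A, f A ∂(Pizzetti.stiefelMeasure b n m))) := by
  obtain ⟨Ψ, hΨ⟩ := Pizzetti.exists_representsPsiHat b n m
  refine ⟨Ψ, fun Φ => ⟨fun hΦ => ?_, fun h => h ▸ hΨ⟩, fun f hf =>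
    Pizzetti.tendsto_diffOp_of_mem_analyticSpace hΨ hf⟩
  refine Pizzetti.homPart_ext (b := b) fun e B => ?_
  rw [Pizzetti.representsPsiHat_iff.1 hΦ, Pizzetti.representsPsiHat_iff.1 hΨ]
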